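/- For integers $Q\ge 3$ let $\mathfrak{SF}_Q$ be the set of $\operatorname{SL}(2,\mathbb N)$-saturated Farey fractions, that is, of all fractions $d/b$ for which there are positive integers $a,c$ with $ad-bc=1$, $a\ge b\ge d\ge 1$, $a\ge c\ge d$ and $a+d\le Q$. Let $\mathscr D_Q$ be the set of pairs $(q_1,q_2)$ of denominators of consecutive elements $a_1/q_1<a_2/q_2$ (in lowest terms) of $\mathfrak{SF}_Q$. Let $$\mathcal V=\Big\{(x,y)\in[0,1]^2:\ \max\big\{\tfrac{1-3x}{2},2x-1\big\}\le y\le\max\{1-x,x\}\Big\}.$$ Then $\mathcal V=\mathcal V_1\cup\mathcal V_2\cup\mathcal V_3$, where the three sets $$\mathcal V_1=\Big\{(x,y)\in[\tfrac12,1]\times[\tfrac13,1]:\ \max\{1-x,2x-1\}\le y\le x\Big\},$$ $$\mathcal V_2=\Big\{(x,y)\in[0,\tfrac12]\times[\tfrac15,1]:\ \max\big\{\tfrac{1-3x}{2},x\big\}\le y\le 1-x\Big\},$$ $$\mathcal V_3=\Big\{(x,y)\in[\tfrac15,\tfrac23]\times[0,\tfrac12]:\ \max\big\{\tfrac{1-3x}{2},0,2x-1\big\}\le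 y\le\min\{x,1-x\}\Big\}$$ have pairwise disjoint interiors, and the scaled sets $Q^{-1}\mathscr D_Q$ have a limiting distribution on $\mathcal V$ in the following sense. Put $$H_1(x,y)=\frac{1+y-2x}{x},$$ $$H_2(x,y)=\min\Big\{\frac{1+y-(2+\lfloor y/x\rfloor)x}{x},\frac{1-x-y}{y},1\Big\}-\max\Big\{\frac{1-2x-y}{x+y},0\Big\},$$ $$H_3(x,y)=\min\Big\{\frac{3x+2y-1}{x+y},1\Big\}-\max\Big\{\frac{3x-y-1}{x},\frac{x+(2-\lfloor x/y\rfloor)y-1}{y},0\Big\}.$$ For $i=1,2,3$ we have $H_i>0$ on the interior of $\mathcal V_i$, and for every rectangular box $\mathcal R=I\times J\subseteq\mathcal V_i$ (with $I,J$ intervals) the function $H_i$ is integrable on $\mathcal R$ and $$\lim_{Q\to\infty}\frac{\#(\mathscr D_Q\cap Q\mathcal R)}{\#\mathscr D_Q}=\frac{2}{\log(4/3)}\iint_{\mathcal R}H_i(x,y)\,dx\,dy.$$ -/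

import Mathlib

open Filter Topology MeasureTheory

namespace SaturatedFarey

/-- The `SL(2, ℕ)`-saturated Farey fractions of level `Q`: the fractions `d / b` for which there is
a matrix `(a b; c d)` of determinant `1` with positive integer entries such that
`a ≥ b ≥ d ≥ 1`, `a ≥ c ≥ d` and `a + d ≤ Q`. The determinant condition forces `d / b` to be in
lowest terms. -/
def fractions (Q : ℕ) : Set ℚ :=
  {x | ∃ a b c d : ℕ, (a : ℤ) * d - (b : ℤ) * c = 1 ∧
    b ≤ a ∧ d ≤ b ∧ 1 ≤ d ∧ c ≤ a ∧ d ≤ c ∧ a + d ≤ Q ∧ x = (d : ℚ) / (b : ℚ)}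

/-- The set of pairs `(q₁, q₂)` of denominators (in lowest terms) of consecutive elements
`x < y` of `fractions Q`. -/
def denominators (Q : ℕ) : Set (ℕ × ℕ) :=
  {p | ∃ x ∈ fractions Q, ∃ y ∈ fractions Q, x < y ∧
    (∀ z ∈ fractions Q, ¬ (x < z ∧ z < y)) ∧ p = (x.den, y.den)}

/-- The pairs of `denominators Q` that lie in the dilated set `Q • R`. -/
def denominatorsIn (Q : ℕ) (R : Set (ℝ × ℝ)) : Set (ℕ × ℕ) :=
  {p | p ∈ denominators Q ∧ ∃ r ∈ R, (p.1 : ℝ) = Q * r.1 ∧ (p.2 : ℝ) = Q * r.2}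

/-- `fractions Q` is finite. -/
theorem fractions_finite (Q : ℕ) : (fractions Q).Finite := by
  refine (((Set.finite_Iic Q).prod (Set.finite_Iic Q)).image
    (fun p : ℕ × ℕ => (p.1 : ℚ) / (p.2 : ℚ))).subset ?_
  rintro x ⟨a, b, c, d, _, hba, _, _, _, _, hQ, rfl⟩
  exact ⟨(d, b), ⟨by simp only [Set.mem_Iic]; omega, by simp only [Set.mem_Iic]; omega⟩, rfl⟩

/-- `denominators Q` is finite, so that its `Set.ncard` is its number of elements. -/
theorem denominators_finite (Q : ℕ) : (denominators Q).Finite := by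
  refine (((fractions_finite Q).prod (fractions_finite Q)).image
    (fun p : ℚ × ℚ => (p.1.den, p.2.den))).subset ?_
  rintro p ⟨x, hx, y, hy, _, _, rfl⟩
  exact ⟨(x, y), ⟨hx, hy⟩, rfl⟩

/-- The region `𝒱`. -/
def V : Set (ℝ × ℝ) :=
  {p | p.1 ∈ Set.Icc (0 : ℝ) 1 ∧ p.2 ∈ Set.Icc (0 : ℝ) 1 ∧
    max ((1 - 3 * p.1) / 2) (2 * p.1 - 1) ≤ p.2 ∧ p.2 ≤ max (1 - p.1) p.1}

/-- The region `𝒱₁`. -/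
def V₁ : Set (ℝ × ℝ) :=
  {p | p.1 ∈ Set.Icc (1 / 2 : ℝ) 1 ∧ p.2 ∈ Set.Icc (1 / 3 : ℝ) 1 ∧
    max (1 - p.1) (2 * p.1 - 1) ≤ p.2 ∧ p.2 ≤ p.1}

/-- The region `𝒱₂`. -/
def V₂ : Set (ℝ × ℝ) :=
  {p | p.1 ∈ Set.Icc (0 : ℝ) (1 / 2) ∧ p.2 ∈ Set.Icc (1 / 5 : ℝ) 1 ∧
    max ((1 - 3 * p.1) / 2) p.1 ≤ p.2 ∧ p.2 ≤ 1 - p.1}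

/-- The region `𝒱₃`. -/
def V₃ : Set (ℝ × ℝ) :=
  {p | p.1 ∈ Set.Icc (1 / 5 : ℝ) (2 / 3) ∧ p.2 ∈ Set.Icc (0 : ℝ) (1 / 2) ∧
    max (max ((1 - 3 * p.1) / 2) 0) (2 * p.1 - 1) ≤ p.2 ∧ p.2 ≤ min p.1 (1 - p.1)}

/-- The three regions `𝒱₁`, `𝒱₂`, `𝒱₃`, indexed by `0, 1, 2`. -/
def region : Fin 3 → Set (ℝ × ℝ) := ![V₁, V₂, V₃]

/-- The density on `𝒱₁`. -/
noncomputable def H₁ (p : ℝ × ℝ) : ℝ := (1 + p.2 - 2 * p.1) / p.1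

/-- The density on `𝒱₂`. The value on the null set `p.1 = 0` plays no role. -/
noncomputable def H₂ (p : ℝ × ℝ) : ℝ :=
  min (min ((1 + p.2 - (2 + (⌊p.2 / p.1⌋ : ℝ)) * p.1) / p.1) ((1 - p.1 - p.2) / p.2)) 1
    - max ((1 - 2 * p.1 - p.2) / (p.1 + p.2)) 0

/-- The density on `𝒱₃`. The value on the null set `p.2 = 0` plays no role. -/
noncomputable def H₃ (p : ℝ × ℝ) : ℝ :=
  min ((3 * p.1 + 2 * p.2 - 1) / (p.1 + p.2)) 1
    - max (max ((3 * p.1 - p.2 - 1) / p.1)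
        ((p.1 + (2 - (⌊p.1 / p.2⌋ : ℝ)) * p.2 - 1) / p.2)) 0

/-- The three densities, indexed by `0, 1, 2`. -/
noncomputable def density : Fin 3 → ℝ × ℝ → ℝ := ![H₁, H₂, H₃]

end SaturatedFarey

/-! Subtracting the second column of the matrix from the first shows that `d/b` is saturated exactly
when `b + d + t ≤ Q` for some `t` inverse to `d` modulo `b`; the least such `t` decides. In terms of
a modulus and a reduced residue this is the set `saturated`, whose condition is symmetric in a
residue and its inverse.

Two saturated fractions are consecutive iff they are unimodular and their mediant is not saturated
(`mem_denominators_iff`). Of a unimodular pair, the fraction with the smaller denominator is a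
parent of the other, and parents inherit saturation. So membership of `(q₁, q₂)` in `denominators Q`
reduces to one condition on the larger denominator minus one condition on the mediant: `(q₁, q₁ -
q₂)` or `(q₂, q₁)` lies in `saturated Q`, and `(q₁ + q₂, q₁)` does not. As a saturated mediant
forces the first condition (`saturated_of_mediant`), the count in a region is a difference of two
counts of `saturated` in linear preimages of the region, up to `O(Q)` coming from `q₁ = 1`.

These counts follow from the joint equidistribution of `(b / N, r / b, r⁻¹ / b)` over all reduced
residues `r` modulo `b ≤ N`, with limit `2 x dx du dv` on the cube. By Weyl's criterion on the torus
this amounts to Kloosterman sums modulo `b` being `o(φ(b))` (`isLittleO_expSum`); Kloosterman's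
elementary fourth moment argument and a divisor bound suffice. Integrating out the inverse gives
`weight` as limiting density of `saturated` (`tendsto_card_saturated`), normalised by the sum of
`φ(n)` for `n ≤ N`.

Hence the unnormalised density of the pairs is `weight ∘ reflect - weight ∘ child` below the
diagonal and `weight ∘ Prod.swap - weight ∘ child` above it. On the three regions this equals `2 *
density i` almost everywhere, the floor terms being inactive. The total mass is `W + W - W = W`,
where `W`, the integral of `weight`, is `log (4 / 3)` (`integral_weight`); this is the normalising
constant. -/

namespace SaturatedFarey

/-! ### Kloosterman's fourth moment bound -/

section Kloosterman

open Finset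

/-- Dividing `m * x.val` by `b` leaves the fixed remainder `c.val`, so the quotient, which is less
than `m`, determines `x`. -/
theorem card_natCast_mul_eq_le (b : ℕ) [NeZero b] {m : ℕ} (hm : 0 < m) (c : ZMod b) :
    #{x : ZMod b | (m : ZMod b) * x = c} ≤ m := by
  have hb : 0 < b := Nat.pos_of_ne_zero (NeZero.ne b)
  have key : ∀ x : ZMod b, (m : ZMod b) * x = c → m * x.val % b = c.val := by
    intro x hx
    rw [← ZMod.val_natCast, ← hx]
    simp
  calc #{x : ZMod b | (m : ZMod b) * x = c} ≤ #(range m) := by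
        refine card_le_card_of_injOn (fun x => m * x.val / b) ?_ ?_
        · intro x _
          simp only [coe_range, Set.mem_Iio]
          rw [Nat.div_lt_iff_lt_mul hb]
          exact Nat.mul_lt_mul_of_pos_left (ZMod.val_lt x) hm
        · intro x hx y hy hxy
          simp only [coe_filter, mem_univ, true_and, Set.mem_ofPred_eq] at hx hy
          have h1 := Nat.div_add_mod (m * x.val) b
          have h2 := Nat.div_add_mod (m * y.val) b
          rw [key x hx] at h1
          rw [key y hy] at h2
          simp only at hxy
          rw [hxy] at h1
          exact ZMod.val_injective b (Nat.eq_of_mul_eq_mul_left hm (h1.symm.trans h2))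
    _ = m := card_range m

theorem card_intCast_mul_eq_le (b : ℕ) [NeZero b] {m : ℤ} (hm : m ≠ 0) (c : ZMod b) :
    #{x : ZMod b | (m : ZMod b) * x = c} ≤ m.natAbs := by
  have hpos : 0 < m.natAbs := Int.natAbs_pos.mpr hm
  rcases Int.natAbs_eq m with h | h
  · have := card_natCast_mul_eq_le b hpos c
    have hc : (m : ZMod b) = (m.natAbs : ZMod b) := by
      conv_lhs => rw [h]
      simp
    rwa [hc]
  · have := card_natCast_mul_eq_le b hpos (-c)
    have hc : (m : ZMod b) = -(m.natAbs : ZMod b) := by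
      conv_lhs => rw [h]
      simp
    rw [hc]
    simpa [neg_mul, neg_eq_iff_eq_neg] using this

/-- By Bézout the gcd is a multiple of `a` modulo `b`, so it also annihilates `x`. -/
theorem card_mul_eq_zero_le (b : ℕ) [NeZero b] (a : ZMod b) :
    #{x : ZMod b | a * x = 0} ≤ a.val.gcd b := by
  have hb : 0 < b := Nat.pos_of_ne_zero (NeZero.ne b)
  refine le_trans (card_le_card ?_)
    (card_natCast_mul_eq_le b (Nat.gcd_pos_of_pos_right a.val hb) 0)
  intro x hx
  simp only [mem_filter, mem_univ, true_and] at hx ⊢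
  have h := congrArg (Int.cast : ℤ → ZMod b) (Nat.gcd_eq_gcd_ab a.val b)
  push_cast at h
  rw [h]
  simp only [ZMod.natCast_val, ZMod.cast_id', id, CharP.cast_eq_zero, zero_mul, add_zero]
  rw [mul_right_comm, hx, zero_mul]

/-- For each divisor `d` of `b` at most `b / d` residues are divisible by `d`, so the residues with
gcd `d` contribute at most `b`. -/
theorem sum_gcd_le (b : ℕ) [NeZero b] :
    ∑ a : ZMod b, a.val.gcd b ≤ b * #b.divisors := by
  have hb : 0 < b := Nat.pos_of_ne_zero (NeZero.ne b)
  -- The first conjunct holds for every divisor `d` of `b`; the term `d = gcd` alone gives the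
  -- bound.
  have h1 : ∀ a : ZMod b, a.val.gcd b ≤
      ∑ d ∈ b.divisors, if ((d : ℕ) : ZMod b) * ((b / d : ℕ) : ZMod b) = 0 ∧ d ∣ a.val
        then d else 0 := by
    intro a
    have hm : a.val.gcd b ∈ b.divisors :=
      Nat.mem_divisors.mpr ⟨Nat.gcd_dvd_right _ _, hb.ne'⟩
    refine le_trans ?_ (single_le_sum (fun d _ => Nat.zero_le _) hm)
    rw [if_pos]
    refine ⟨?_, Nat.gcd_dvd_left _ _⟩
    rw [← Nat.cast_mul, Nat.mul_div_cancel' (Nat.gcd_dvd_right _ _)]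
    simp
  calc ∑ a : ZMod b, a.val.gcd b
      ≤ ∑ a : ZMod b, ∑ d ∈ b.divisors,
        if ((d : ℕ) : ZMod b) * ((b / d : ℕ) : ZMod b) = 0 ∧ d ∣ a.val then d else 0 :=
        sum_le_sum fun a _ => h1 a
    _ = ∑ d ∈ b.divisors, ∑ a : ZMod b,
        if ((d : ℕ) : ZMod b) * ((b / d : ℕ) : ZMod b) = 0 ∧ d ∣ a.val then d else 0 := sum_comm
    _ ≤ ∑ d ∈ b.divisors, b := by
        refine sum_le_sum fun d hd => ?_
        have hdb := Nat.dvd_of_mem_divisors hd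
        have hd0 : 0 < d := Nat.pos_of_dvd_of_pos hdb hb
        rw [← sum_filter, sum_const, smul_eq_mul]
        have : #{a : ZMod b | ((d : ℕ) : ZMod b) * ((b / d : ℕ) : ZMod b) = 0 ∧ d ∣ a.val}
            ≤ b / d := by
          calc _ ≤ #{x : ZMod b | ((b / d : ℕ) : ZMod b) * x = 0} := by
                refine card_le_card ?_
                intro a ha
                simp only [mem_filter, mem_univ, true_and] at ha ⊢
                obtain ⟨-, k, hk⟩ := ha
                have : a = ((d * k : ℕ) : ZMod b) := by rw [← hk]; simp
                rw [this, ← Nat.cast_mul, ← mul_assoc, Nat.div_mul_cancel hdb]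
                simp
            _ ≤ b / d := card_natCast_mul_eq_le b (Nat.div_pos (Nat.le_of_dvd hb hdb) hd0) 0
        calc _ ≤ b / d * d := Nat.mul_le_mul_right d this
          _ = b := Nat.div_mul_cancel hdb
    _ = b * #b.divisors := by rw [sum_const, smul_eq_mul, mul_comm]

/-- For fixed `x, y` there are at most `gcd(xy, b) ≤ gcd(x, b) gcd(y, b)` values of `z`, and the
double sum factors. -/
theorem card_mul_mul_eq_zero_le (b : ℕ) [NeZero b] :
    #{p : ZMod b × ZMod b × ZMod b | p.1 * p.2.1 * p.2.2 = 0} ≤ (b * #b.divisors) ^ 2 := by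
  have hb : 0 < b := Nat.pos_of_ne_zero (NeZero.ne b)
  have h : #{p : ZMod b × ZMod b × ZMod b | p.1 * p.2.1 * p.2.2 = 0} =
      ∑ x : ZMod b, ∑ y : ZMod b, #{z : ZMod b | x * y * z = 0} := by
    rw [card_filter, Fintype.sum_prod_type]
    refine sum_congr rfl fun x _ => ?_
    rw [Fintype.sum_prod_type]
    refine sum_congr rfl fun y _ => ?_
    rw [card_filter]
  rw [h, pow_two]
  calc ∑ x : ZMod b, ∑ y : ZMod b, #{z : ZMod b | x * y * z = 0}
      ≤ ∑ x : ZMod b, ∑ y : ZMod b, x.val.gcd b * y.val.gcd b := by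
        refine sum_le_sum fun x _ => sum_le_sum fun y _ => ?_
        refine (card_mul_eq_zero_le b (x * y)).trans ?_
        rw [ZMod.val_mul]
        have : (x.val * y.val % b).gcd b = (x.val * y.val).gcd b := by
          rw [← Nat.gcd_rec, Nat.gcd_comm]
        rw [this]
        refine Nat.le_of_dvd (Nat.mul_pos (Nat.gcd_pos_of_pos_right _ hb)
          (Nat.gcd_pos_of_pos_right _ hb)) ?_
        rw [Nat.gcd_comm _ b, Nat.gcd_comm _ b, Nat.gcd_comm _ b]
        exact Nat.gcd_mul_right_dvd_mul_gcd b _ _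
    _ = (∑ x : ZMod b, x.val.gcd b) * ∑ y : ZMod b, y.val.gcd b := by rw [sum_mul_sum]
    _ ≤ _ := Nat.mul_le_mul (sum_gcd_le b) (sum_gcd_le b)

/-- Eliminating `w = x + y - z` from the second equation gives `(x + y)(z - x)(y - z) = 0`. The
three factors add up to `2y`, so they leave at most two choices of `y`, and `y` then determines the
quadruple. -/
theorem card_unit_quadruples_le (b : ℕ) [NeZero b] :
    #{p : (ZMod b)ˣ × (ZMod b)ˣ × (ZMod b)ˣ × (ZMod b)ˣ |
      (p.1 + p.2.1 - p.2.2.1 - p.2.2.2 : ZMod b) = 0 ∧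
      (↑p.1⁻¹ + ↑p.2.1⁻¹ - ↑p.2.2.1⁻¹ - ↑p.2.2.2⁻¹ : ZMod b) = 0} ≤
    2 * (b * #b.divisors) ^ 2 := by
  refine le_trans ?_ (Nat.mul_le_mul_left 2 (card_mul_mul_eq_zero_le b))
  refine card_le_mul_card_image_of_maps_to
    (f := fun p : (ZMod b)ˣ × (ZMod b)ˣ × (ZMod b)ˣ × (ZMod b)ˣ =>
      ((p.1 + p.2.1 : ZMod b), (p.2.2.1 - p.1 : ZMod b), (p.2.1 - p.2.2.1 : ZMod b))) ?_ 2 ?_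
  · rintro ⟨x, y, z, w⟩ h
    simp only [mem_filter, mem_univ, true_and] at h ⊢
    obtain ⟨h1, h2⟩ := h
    have hx : (x : ZMod b) * ↑x⁻¹ = 1 := x.mul_inv
    have hy : (y : ZMod b) * ↑y⁻¹ = 1 := y.mul_inv
    have hz : (z : ZMod b) * ↑z⁻¹ = 1 := z.mul_inv
    have hw : (w : ZMod b) * ↑w⁻¹ = 1 := w.mul_inv
    generalize ((x⁻¹ : (ZMod b)ˣ) : ZMod b) = x' at *
    generalize ((y⁻¹ : (ZMod b)ˣ) : ZMod b) = y' at *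
    generalize ((z⁻¹ : (ZMod b)ˣ) : ZMod b) = z' at *
    generalize ((w⁻¹ : (ZMod b)ˣ) : ZMod b) = w' at *
    generalize (x : ZMod b) = x at *
    generalize (y : ZMod b) = y at *
    generalize (z : ZMod b) = z at *
    generalize (w : ZMod b) = w at *
    obtain rfl : w = x + y - z := by linear_combination -h1
    have h3 : (x + y) * z * (x + y - z) - (x + y) * x * y = 0 := by
      linear_combination (x * y * z * (x + y - z)) * h2 - y * z * (x + y - z) * hx
        - x * z * (x + y - z) * hy + x * y * (x + y - z) * hz + x * y * z * hw
    linear_combination h3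
  · rintro ⟨A, B, C⟩ -
    refine le_trans ?_ (card_natCast_mul_eq_le b two_pos (A + B + C))
    refine card_le_card_of_injOn (fun p => (p.2.1 : ZMod b)) ?_ ?_
    · rintro ⟨x, y, z, w⟩ h
      simp only [coe_filter, mem_filter, mem_univ, true_and, Set.mem_ofPred_eq,
        Prod.mk.injEq] at h ⊢
      obtain ⟨-, h1, h2, h3⟩ := h
      rw [← h1, ← h2, ← h3]
      push_cast
      ring
    · rintro ⟨x, y, z, w⟩ h ⟨x', y', z', w'⟩ h' hy
      simp only [coe_filter, mem_filter, mem_univ, true_and, Set.mem_ofPred_eq,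
        Prod.mk.injEq] at h h' hy ⊢
      obtain ⟨⟨h0, -⟩, h1, h2, h3⟩ := h
      obtain ⟨⟨h0', -⟩, h1', h2', h3'⟩ := h'
      refine ⟨Units.ext ?_, Units.ext ?_, Units.ext ?_, Units.ext ?_⟩
      · linear_combination h1 - h1' - hy
      · exact hy
      · linear_combination h3' - h3 + hy
      · linear_combination h0' - h0 + h1 - h1' - h3' + h3 - hy

/-- The Kloosterman sum modulo `b`. -/
noncomputable def kloosterman (b : ℕ) [NeZero b] (m n : ZMod b) : ℂ :=
  ∑ u : (ZMod b)ˣ, ZMod.stdAddChar (m * (u : ZMod b) + n * (↑u⁻¹ : ZMod b))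

theorem kloosterman_comm (b : ℕ) [NeZero b] (m n : ZMod b) :
    kloosterman b m n = kloosterman b n m := by
  refine Fintype.sum_equiv (Equiv.inv _) _ _ fun u => ?_
  simp [add_comm]

theorem kloosterman_mul_unit (b : ℕ) [NeZero b] (m n : ZMod b) (w : (ZMod b)ˣ) :
    kloosterman b (m * w) (n * ↑w⁻¹) = kloosterman b m n := by
  refine Fintype.sum_equiv (Equiv.mulLeft w) _ _ fun u => ?_
  simp only [Equiv.coe_mulLeft, mul_inv, Units.val_mul]
  congr 1
  ring

theorem norm_kloosterman_pow_four (b : ℕ) [NeZero b] (m n : ZMod b) :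
    ((‖kloosterman b m n‖ ^ 4 : ℝ) : ℂ) =
      ∑ p : (ZMod b)ˣ × (ZMod b)ˣ × (ZMod b)ˣ × (ZMod b)ˣ,
        ZMod.stdAddChar (m * (p.1 + p.2.1 - p.2.2.1 - p.2.2.2 : ZMod b)) *
        ZMod.stdAddChar
          (n * (↑p.1⁻¹ + ↑p.2.1⁻¹ - ↑p.2.2.1⁻¹ - ↑p.2.2.2⁻¹ : ZMod b)) := by
  have hconj : (starRingEnd ℂ) (kloosterman b m n) =
      ∑ u : (ZMod b)ˣ, ZMod.stdAddChar (-(m * (u : ZMod b) + n * (↑u⁻¹ : ZMod b))) := by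
    rw [kloosterman, map_sum]
    exact sum_congr rfl fun u _ => (AddChar.map_neg_eq_conj _ _).symm
  have h4 : ((‖kloosterman b m n‖ ^ 4 : ℝ) : ℂ) =
      kloosterman b m n * (kloosterman b m n *
        ((starRingEnd ℂ) (kloosterman b m n) * (starRingEnd ℂ) (kloosterman b m n))) := by
    have := Complex.mul_conj' (kloosterman b m n)
    push_cast
    linear_combination (-(‖kloosterman b m n‖ : ℂ) ^ 2 -
      kloosterman b m n * (starRingEnd ℂ) (kloosterman b m n)) * this
  rw [h4, hconj, kloosterman, Finset.sum_mul_sum, Finset.sum_mul_sum, Finset.sum_mul_sum]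
  simp only [Fintype.sum_prod_type, Finset.mul_sum]
  refine sum_congr rfl fun x _ => sum_congr rfl fun y _ => sum_congr rfl fun z _ =>
    sum_congr rfl fun w _ => ?_
  simp only [← AddChar.map_add_eq_mul]
  congr 1
  ring

/-- Orthogonality of characters in both frequencies turns the fourth moment into `b ^ 2` times the
number of quadruples. -/
theorem sum_norm_kloosterman_pow_four_le (b : ℕ) [NeZero b] :
    ∑ p : ZMod b × ZMod b, ‖kloosterman b p.1 p.2‖ ^ 4 ≤
      2 * (b : ℝ) ^ 4 * (#b.divisors : ℝ) ^ 2 := by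
  have h : ∑ p : ZMod b × ZMod b, ‖kloosterman b p.1 p.2‖ ^ 4 = (b : ℝ) ^ 2 *
      #{p : (ZMod b)ˣ × (ZMod b)ˣ × (ZMod b)ˣ × (ZMod b)ˣ |
        (p.1 + p.2.1 - p.2.2.1 - p.2.2.2 : ZMod b) = 0 ∧
        (↑p.1⁻¹ + ↑p.2.1⁻¹ - ↑p.2.2.1⁻¹ - ↑p.2.2.2⁻¹ : ZMod b) = 0} := by
    rw [← Complex.ofReal_inj, Complex.ofReal_sum]
    simp only [norm_kloosterman_pow_four]
    rw [sum_comm, card_filter]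
    push_cast
    rw [Finset.mul_sum]
    refine sum_congr rfl fun q _ => ?_
    rw [Fintype.sum_prod_type]
    simp only
    rw [← Finset.sum_mul_sum, AddChar.sum_mulShift _ (ZMod.isPrimitive_stdAddChar b),
      AddChar.sum_mulShift _ (ZMod.isPrimitive_stdAddChar b), ZMod.card]
    split_ifs <;> simp_all [pow_two]
  rw [h]
  have := card_unit_quadruples_le b
  calc _ ≤ (b : ℝ) ^ 2 * (2 * (b * #b.divisors) ^ 2 : ℕ) := by gcongr
    _ = _ := by push_cast; ring

/-- The substitution `u ↦ w u` gives the same sum at all frequencies `(m w, n w⁻¹)`, so a single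
value occurs `φ(b)` times in the full fourth moment. Each frequency pair is hit by at most `|m|`
units `w`, since `m w` takes a given value at most that often. -/
theorem totient_mul_norm_kloosterman_pow_four_le (b : ℕ) [NeZero b] {m : ℤ} (hm : m ≠ 0)
    (n : ZMod b) :
    (b.totient : ℝ) * ‖kloosterman b m n‖ ^ 4 ≤
      m.natAbs * (2 * (b : ℝ) ^ 4 * (#b.divisors : ℝ) ^ 2) := by
  have h1 : (b.totient : ℝ) * ‖kloosterman b m n‖ ^ 4 =
      ∑ w : (ZMod b)ˣ, ‖kloosterman b (m * w) (n * ↑w⁻¹)‖ ^ 4 := by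
    simp only [kloosterman_mul_unit, sum_const, card_univ, ZMod.card_units_eq_totient,
      nsmul_eq_mul]
  rw [h1]
  have h2 := Finset.sum_comp (s := (univ : Finset (ZMod b)ˣ))
    (fun p : ZMod b × ZMod b => ‖kloosterman b p.1 p.2‖ ^ 4)
    (fun w : (ZMod b)ˣ => ((m : ZMod b) * w, n * ((w⁻¹ : (ZMod b)ˣ) : ZMod b)))
  simp only at h2
  rw [h2]
  calc _ ≤ ∑ p ∈ univ.image
        (fun w : (ZMod b)ˣ => ((m : ZMod b) * w, n * ((w⁻¹ : (ZMod b)ˣ) : ZMod b))),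
        (m.natAbs : ℝ) * ‖kloosterman b p.1 p.2‖ ^ 4 := by
        refine sum_le_sum fun p _ => ?_
        rw [nsmul_eq_mul]
        gcongr
        refine le_trans ?_ (card_intCast_mul_eq_le b hm p.1)
        refine card_le_card_of_injOn (fun w => (w : ZMod b)) ?_ ?_
        · intro w hw
          simp only [coe_filter, mem_univ, true_and, Set.mem_ofPred_eq] at hw ⊢
          rw [← hw]
        · exact fun w _ w' _ h => Units.ext h
    _ ≤ ∑ p : ZMod b × ZMod b, (m.natAbs : ℝ) * ‖kloosterman b p.1 p.2‖ ^ 4 :=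
        sum_le_sum_of_subset_of_nonneg (subset_univ _) fun _ _ _ => by positivity
    _ = m.natAbs * ∑ p : ZMod b × ZMod b, ‖kloosterman b p.1 p.2‖ ^ 4 := by rw [mul_sum]
    _ ≤ _ := by gcongr; exact sum_norm_kloosterman_pow_four_le b

end Kloosterman

/-! ### Divisor and totient bounds -/

section DivisorBound

open Finset

theorem succ_pow_eight_le (v : ℕ) : (v + 1) ^ 8 ≤ 8 ^ 8 * 2 ^ v := by
  have h1 : v + 1 ≤ 8 * 2 ^ (v / 8) := by
    have : v / 8 + 1 ≤ 2 ^ (v / 8) := Nat.lt_two_pow_self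
    omega
  calc (v + 1) ^ 8 ≤ (8 * 2 ^ (v / 8)) ^ 8 := Nat.pow_le_pow_left h1 8
    _ = 8 ^ 8 * 2 ^ (v / 8 * 8) := by rw [mul_pow, ← pow_mul]
    _ ≤ 8 ^ 8 * 2 ^ v := by gcongr; exacts [one_le_two, Nat.div_mul_le_self v 8]

/-- A prime `p ≥ 256 = 2 ^ 8` of exponent `v` costs nothing, because `(v + 1) ^ 8 ≤ 2 ^ (8 v) ≤ p ^
v`. Each of the fewer than 256 smaller primes costs a factor of at most `8 ^ 8`. -/
theorem card_divisors_pow_eight_le {n : ℕ} (hn : n ≠ 0) :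
    #n.divisors ^ 8 ≤ (8 ^ 8) ^ 256 * n := by
  rw [Nat.card_divisors hn, ← prod_pow]
  have h1 : ∀ p ∈ n.primeFactors, (n.factorization p + 1) ^ 8 ≤
      (if p < 256 then 8 ^ 8 else 1) * p ^ n.factorization p := by
    intro p hp
    have hp2 := (Nat.prime_of_mem_primeFactors hp).two_le
    split_ifs with h
    · refine (succ_pow_eight_le _).trans ?_
      gcongr
    · rw [one_mul]
      calc (n.factorization p + 1) ^ 8 ≤ (2 ^ n.factorization p) ^ 8 :=
            Nat.pow_le_pow_left Nat.lt_two_pow_self 8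
        _ = 256 ^ n.factorization p := by rw [← pow_mul, mul_comm, pow_mul]; norm_num
        _ ≤ _ := Nat.pow_le_pow_left (not_lt.mp h) _
  refine (prod_le_prod' h1).trans ?_
  rw [prod_mul_distrib]
  gcongr
  · rw [← prod_filter, prod_const]
    refine Nat.pow_le_pow_right (by norm_num) ?_
    calc _ ≤ #(range 256) := card_le_card fun p hp => by simpa using (mem_filter.mp hp).2
      _ = 256 := card_range _
  · exact (Nat.prod_factorization_pow_eq_self hn).le

/-- In `n = ∑ φ(d)` over the divisors `d` of `n`, every term is at most `φ(n)`. -/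
theorem le_totient_mul_card_divisors (n : ℕ) : n ≤ n.totient * #n.divisors := by
  conv_lhs => rw [← Nat.sum_totient n]
  rw [mul_comm, ← smul_eq_mul]
  refine sum_le_card_nsmul _ _ _ fun d hd => ?_
  have hn : n ≠ 0 := (Nat.mem_divisors.mp hd).2
  exact Nat.le_of_dvd (Nat.totient_pos.mpr (Nat.pos_of_ne_zero hn))
    (Nat.totient_dvd_of_dvd (Nat.dvd_of_mem_divisors hd))

end DivisorBound

/-! ### Kloosterman sums are `o(φ(b))` -/

section ExponentialSum

open Finset

/-- The representative in `[0, b)` of the inverse of `r` modulo `b`. -/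
def modInv (b r : ℕ) : ℕ := ((r : ZMod b)⁻¹).val

/-- The Kloosterman sum modulo `b` with integral frequencies, as a sum over residues. -/
noncomputable def expSum (m n : ℤ) (b : ℕ) : ℂ :=
  ∑ r ∈ range b with b.Coprime r,
    Complex.exp (2 * Real.pi * Complex.I * (m * (r / b : ℂ) + n * (modInv b r / b : ℂ)))

theorem expSum_eq_kloosterman (m n : ℤ) (b : ℕ) [NeZero b] :
    expSum m n b = kloosterman b m n := by
  symm
  refine sum_bij (fun u _ => (u : ZMod b).val) ?_ ?_ ?_ ?_
  · intro u _
    simp only [mem_filter, mem_range]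
    exact ⟨ZMod.val_lt _, (ZMod.val_coe_unit_coprime u).symm⟩
  · exact fun u _ v _ h => Units.ext (ZMod.val_injective b h)
  · intro r hr
    simp only [mem_filter, mem_range] at hr
    refine ⟨ZMod.unitOfCoprime r hr.2.symm, mem_univ _, ?_⟩
    rw [ZMod.coe_unitOfCoprime, ZMod.val_natCast, Nat.mod_eq_of_lt hr.1]
  · intro u _
    have h : (m * (u : ZMod b) + n * (↑u⁻¹ : ZMod b)) =
        ((m * ((u : ZMod b).val : ℤ) + n * ((↑u⁻¹ : ZMod b).val : ℤ) : ℤ) : ZMod b) := by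
      push_cast
      simp
    have h2 : modInv b (u : ZMod b).val = (↑u⁻¹ : ZMod b).val := by
      rw [modInv, ZMod.natCast_zmod_val, ZMod.inv_coe_unit]
    rw [h, ZMod.stdAddChar_coe, h2]
    congr 1
    push_cast
    ring

/-- Two divisor factors from the fourth moment and five from `b ≤ φ τ` give `K ^ 4 * b ≤ 2 |m| τ ^ 7
φ ^ 4`. In the eighth power `τ ^ 56 ≤ C ^ 7 b ^ 7` meets `b ^ 8`, and one factor `b` survives. -/
theorem norm_kloosterman_pow_mul_le (b : ℕ) [NeZero b] {m : ℤ} (hm : m ≠ 0) (n : ZMod b) :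
    ‖kloosterman b m n‖ ^ 32 * b ≤
      ((2 * m.natAbs) ^ 8 * ((8 ^ 8) ^ 256) ^ 7) * (b.totient : ℝ) ^ 32 := by
  have hb : 0 < b := Nat.pos_of_ne_zero (NeZero.ne b)
  have hb' : (0 : ℝ) < b := by exact_mod_cast hb
  have hφ : (0 : ℝ) < b.totient := by exact_mod_cast Nat.totient_pos.mpr hb
  have h2 : (b : ℝ) ≤ (b.totient : ℝ) * (#b.divisors : ℝ) := by
    exact_mod_cast le_totient_mul_card_divisors b
  have h3 : (#b.divisors : ℝ) ^ 8 ≤ (8 ^ 8) ^ 256 * (b : ℝ) := by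
    exact_mod_cast card_divisors_pow_eight_le hb.ne'
  set K := ‖kloosterman b m n‖ with hK
  have hK0 : 0 ≤ K := norm_nonneg _
  set τ : ℝ := (#b.divisors : ℝ) with hτ
  set M : ℝ := (m.natAbs : ℝ) with hM
  set φ : ℝ := (b.totient : ℝ) with hφd
  set C : ℝ := (8 ^ 8) ^ 256 with hC
  have hM0 : 0 ≤ M := by positivity
  have hτ0 : 0 ≤ τ := by positivity
  have h1 : φ * K ^ 4 ≤ M * (2 * (b : ℝ) ^ 4 * τ ^ 2) :=
    totient_mul_norm_kloosterman_pow_four_le b hm n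
  have h4 : K ^ 4 * b ≤ 2 * M * τ ^ 7 * φ ^ 4 := by
    refine le_of_mul_le_mul_left ?_ hφ
    calc φ * (K ^ 4 * b) = φ * K ^ 4 * b := by ring
      _ ≤ M * (2 * (b : ℝ) ^ 4 * τ ^ 2) * b := by gcongr
      _ = 2 * M * τ ^ 2 * (b : ℝ) ^ 5 := by ring
      _ ≤ 2 * M * τ ^ 2 * (φ * τ) ^ 5 := by gcongr
      _ = _ := by ring
  have h5 : K ^ 32 * b ^ 8 ≤ ((2 * M) ^ 8 * C ^ 7 * φ ^ 32) * b ^ 7 := by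
    calc K ^ 32 * (b : ℝ) ^ 8 = (K ^ 4 * b) ^ 8 := by ring
      _ ≤ (2 * M * τ ^ 7 * φ ^ 4) ^ 8 := by gcongr
      _ = (2 * M) ^ 8 * (τ ^ 8) ^ 7 * φ ^ 32 := by ring
      _ ≤ (2 * M) ^ 8 * (C * b) ^ 7 * φ ^ 32 := by gcongr
      _ = _ := by ring
  refine le_of_mul_le_mul_right ?_ (pow_pos hb' 7)
  calc K ^ 32 * b * (b : ℝ) ^ 7 = K ^ 32 * b ^ 8 := by ring
    _ ≤ _ := h5

/-- Kloosterman sums with fixed frequencies are small compared with the number of terms. -/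
theorem isLittleO_expSum {m n : ℤ} (h : m ≠ 0 ∨ n ≠ 0) :
    expSum m n =o[atTop] fun b : ℕ => (b.totient : ℝ) := by
  obtain ⟨C, hC0, hC⟩ : ∃ C : ℝ, 0 ≤ C ∧ ∀ b : ℕ, 0 < b →
      ‖expSum m n b‖ ^ 32 * b ≤ C * (b.totient : ℝ) ^ 32 := by
    rcases h with h | h
    · refine ⟨(2 * m.natAbs) ^ 8 * ((8 ^ 8) ^ 256) ^ 7, by positivity, fun b hb => ?_⟩
      · have : NeZero b := ⟨hb.ne'⟩
        rw [expSum_eq_kloosterman]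
        exact norm_kloosterman_pow_mul_le b h n
    · refine ⟨(2 * n.natAbs) ^ 8 * ((8 ^ 8) ^ 256) ^ 7, by positivity, fun b hb => ?_⟩
      · have : NeZero b := ⟨hb.ne'⟩
        rw [expSum_eq_kloosterman, kloosterman_comm]
        exact norm_kloosterman_pow_mul_le b h m
  rw [Asymptotics.isLittleO_iff]
  intro ε hε
  filter_upwards [eventually_gt_atTop 0,
    tendsto_natCast_atTop_atTop.eventually_ge_atTop (C / ε ^ 32)] with b hb hbC
  have hb' : (0 : ℝ) < b := by exact_mod_cast hb
  rw [Real.norm_natCast]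
  refine le_of_pow_le_pow_left₀ (n := 32) (by norm_num) (by positivity) ?_
  refine le_of_mul_le_mul_right ((hC b hb).trans ?_) hb'
  rw [div_le_iff₀ (by positivity)] at hbC
  calc C * (b.totient : ℝ) ^ 32 ≤ (b * ε ^ 32) * (b.totient : ℝ) ^ 32 := by gcongr
    _ = _ := by ring

end ExponentialSum

/-! ### Averages of Euler's totient -/

section TotientSum

open Finset

/-- The summatory function of Euler's totient. -/
def totientSum (N : ℕ) : ℕ := ∑ n ∈ range (N + 1), n.totient

theorem totientSum_mono : Monotone totientSum := fun a b h =>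
  sum_le_sum_of_subset (range_mono (by omega))

theorem totientSum_pos {N : ℕ} (hN : 0 < N) : 0 < totientSum N :=
  lt_of_lt_of_le (by decide) (totientSum_mono (show 1 ≤ N from hN))

/-- From `φ = μ * id`, summed over the cofactor first. -/
theorem totientSum_eq_sum_moebius (N : ℕ) :
    (totientSum N : ℝ) = ∑ d ∈ Ioc 0 N, (ArithmeticFunction.moebius d : ℝ) *
      (((N / d : ℕ) : ℝ) * ((N / d : ℕ) + 1) / 2) := by
  have h1 : (totientSum N : ℝ) = ∑ n ∈ Ioc 0 N, (n.totient : ℝ) := by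
    have : Ioc 0 N = (range (N + 1)).erase 0 := by ext; simp; omega
    rw [totientSum, Nat.cast_sum, this, Finset.sum_erase]
    simp
  have h2 : ∀ n : ℕ, n > 0 → ∑ i ∈ n.divisors, ((i.totient : ℕ) : ℝ) = (n : ℝ) := fun n _ => by
    exact_mod_cast Nat.sum_totient n
  have h3 := ArithmeticFunction.sum_eq_iff_sum_mul_moebius_eq.mp h2
  have h4 : ∀ n ∈ Ioc 0 N, (n.totient : ℝ) =
      ((ArithmeticFunction.moebius : ArithmeticFunction ℝ) * (ArithmeticFunction.id : ArithmeticFunction ℝ)) n := by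
    intro n hn
    rw [← h3 n (mem_Ioc.mp hn).1, ArithmeticFunction.mul_apply]
    simp
  rw [h1, sum_congr rfl h4, ArithmeticFunction.sum_Ioc_mul_eq_sum_sum]
  refine sum_congr rfl fun d _ => ?_
  have h5 : ∀ k : ℕ, ∑ m ∈ Ioc 0 k, (m : ℝ) = (k : ℝ) * (k + 1) / 2 := by
    intro k
    induction k with
    | zero => simp
    | succ k ih =>
      rw [← Finset.insert_Ioc_right_eq_Ioc_add_one (Nat.zero_le k), sum_insert (by simp), ih]
      push_cast
      ring
  simp [h5]

/-- The constant in the asymptotics of `totientSum`, equal to `3 / π ^ 2`. -/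
noncomputable def totientConst : ℝ :=
  ∑' d : ℕ, (ArithmeticFunction.moebius d : ℝ) * ((1 / d) ^ 2 / 2)

theorem abs_moebius_le (d : ℕ) : |(ArithmeticFunction.moebius d : ℝ)| ≤ 1 := by
  exact_mod_cast ArithmeticFunction.abs_moebius_le_one

theorem summable_totientConst :
    Summable fun d : ℕ => (ArithmeticFunction.moebius d : ℝ) * ((1 / (d : ℝ)) ^ 2 / 2) := by
  refine Summable.of_norm_bounded (g := fun d : ℕ => 1 / (d : ℝ) ^ 2)
    (Real.summable_one_div_nat_pow.mpr one_lt_two) fun d => ?_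
  rw [norm_mul, Real.norm_eq_abs, Real.norm_of_nonneg (by positivity)]
  calc _ ≤ 1 * ((1 / (d : ℝ)) ^ 2 / 2) := by gcongr; exact abs_moebius_le d
    _ ≤ 1 / (d : ℝ) ^ 2 := by
      rw [one_mul, div_pow, one_pow]
      exact half_le_self (by positivity)

/-- Only positivity of the constant is needed. Using `μ(1) = 1` and `μ(d) ≥ -1` otherwise bounds the
series below by `1 - π ^ 2 / 12`. -/
theorem totientConst_pos : 0 < totientConst := by
  have h1 : HasSum (fun d : ℕ => (if d = 1 then (1 : ℝ) else 0) - (1 / (d : ℝ) ^ 2) * (1 / 2))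
      (1 - Real.pi ^ 2 / 6 * (1 / 2)) :=
    (hasSum_ite_eq 1 (1 : ℝ)).sub (hasSum_zeta_two.mul_right (1 / 2))
  have h2 : 1 - Real.pi ^ 2 / 6 * (1 / 2) ≤ totientConst := by
    refine hasSum_le (fun d => ?_) h1 summable_totientConst.hasSum
    rw [div_pow, one_pow]
    split_ifs with hd
    · subst hd
      norm_num
    · have := neg_le_of_abs_le (abs_moebius_le d)
      have h0 : (0 : ℝ) ≤ 1 / (d : ℝ) ^ 2 := by positivity
      nlinarith
  have h3 := Real.pi_lt_d2
  have h4 := Real.pi_pos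
  nlinarith

/-- Dominated convergence for the Möbius series: `⌊N / d⌋ / N` tends to `1 / d`, and each term is at
most `1 / d ^ 2`, the extra `1 / N` being absorbed when `⌊N / d⌋ ≥ 1`. -/
theorem tendsto_totientSum_div_sq :
    Tendsto (fun N : ℕ => (totientSum N : ℝ) / (N : ℝ) ^ 2) atTop (𝓝 totientConst) := by
  have key : Tendsto (fun N : ℕ => ∑' d : ℕ, (ArithmeticFunction.moebius d : ℝ) *
      ((((N / d : ℕ) : ℝ) / N) * (((N / d : ℕ) : ℝ) / N + 1 / N) / 2)) atTop
      (𝓝 totientConst) := by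
    refine tendsto_tsum_of_dominated_convergence (bound := fun d : ℕ => 1 / (d : ℝ) ^ 2)
      (Real.summable_one_div_nat_pow.mpr one_lt_two) (fun d => ?_)
      (Eventually.of_forall fun N d => ?_)
    · have h : Tendsto (fun N : ℕ => ((N / d : ℕ) : ℝ) / N) atTop (𝓝 (1 / d)) := by
        have := (tendsto_nat_floor_mul_div_atTop (R := ℝ) (a := 1 / d) (by positivity)).comp
          tendsto_natCast_atTop_atTop
        refine this.congr fun N => ?_
        simp only [Function.comp]
        rw [one_div_mul_eq_div, Nat.floor_div_eq_div]
      refine Tendsto.const_mul _ ?_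
      have h' := (h.mul (h.add tendsto_one_div_atTop_nhds_zero_nat)).div_const 2
      rw [add_zero, ← pow_two] at h'
      exact h'
    · rw [norm_mul, Real.norm_eq_abs, Real.norm_of_nonneg (by positivity)]
      rcases Nat.eq_zero_or_pos d with rfl | hd
      · simp
      rcases Nat.eq_zero_or_pos N with rfl | hN
      · simp
      have hN' : (0 : ℝ) < N := by exact_mod_cast hN
      have hd' : (0 : ℝ) < d := by exact_mod_cast hd
      set k := N / d with hk
      have h1 : (k : ℝ) / N ≤ 1 / d := by
        rw [div_le_div_iff₀ hN' hd', one_mul]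
        exact_mod_cast Nat.div_mul_le_self N d
      have h2 : (k : ℝ) / N * ((k : ℝ) / N + 1 / N) / 2 ≤ ((k : ℝ) / N) ^ 2 := by
        rcases Nat.eq_zero_or_pos k with h0 | h0
        · simp [h0]
        · have : (1 : ℝ) / N ≤ k / N := by
            gcongr
            exact_mod_cast h0
          have h3 : 0 ≤ (k : ℝ) / N := by positivity
          nlinarith
      calc _ ≤ 1 * ((k : ℝ) / N * ((k : ℝ) / N + 1 / N) / 2) := by
            gcongr; exact abs_moebius_le d
        _ ≤ ((k : ℝ) / N) ^ 2 := by rw [one_mul]; exact h2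
        _ ≤ (1 / d) ^ 2 := by gcongr
        _ = _ := by rw [div_pow, one_pow]
  refine key.congr' ?_
  filter_upwards [eventually_gt_atTop 0] with N hN
  have hN' : (0 : ℝ) < N := by exact_mod_cast hN
  rw [totientSum_eq_sum_moebius, tsum_eq_sum (s := Ioc 0 N), sum_div]
  · refine sum_congr rfl fun d _ => ?_
    field_simp
  · intro d hd
    have : N / d = 0 := by
      rw [Nat.div_eq_zero_iff]
      simp only [mem_Ioc] at hd
      omega
    simp [this]

theorem tendsto_totientSum_atTop : Tendsto (fun N => (totientSum N : ℝ)) atTop atTop := by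
  refine Tendsto.congr' ?_ (tendsto_totientSum_div_sq.pos_mul_atTop totientConst_pos
    ((tendsto_pow_atTop two_ne_zero).comp tendsto_natCast_atTop_atTop))
  filter_upwards [eventually_gt_atTop 0] with N hN
  have hN' : (N : ℝ) ≠ 0 := by exact_mod_cast hN.ne'
  simp only [Function.comp]
  field_simp

theorem tendsto_totientSum_ratio {x : ℝ} (hx : 0 < x) :
    Tendsto (fun N : ℕ => (totientSum ⌊(N : ℝ) * x⌋₊ : ℝ) / totientSum N) atTop (𝓝 (x ^ 2)) := by
  have h1 : Tendsto (fun N : ℕ => ⌊(N : ℝ) * x⌋₊) atTop atTop :=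
    tendsto_nat_floor_atTop.comp (tendsto_natCast_atTop_atTop.atTop_mul_const hx)
  have h2 : Tendsto (fun N : ℕ => (⌊(N : ℝ) * x⌋₊ : ℝ) / N) atTop (𝓝 x) := by
    refine ((tendsto_nat_floor_mul_div_atTop hx.le).comp tendsto_natCast_atTop_atTop).congr
      fun N => ?_
    simp only [Function.comp]
    rw [mul_comm]
  have h3 := ((tendsto_totientSum_div_sq.comp h1).mul (h2.pow 2)).div tendsto_totientSum_div_sq
    totientConst_pos.ne'
  rw [mul_div_cancel_left₀ _ totientConst_pos.ne'] at h3
  refine h3.congr' ?_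
  filter_upwards [eventually_gt_atTop 0, h1.eventually_gt_atTop 0] with N hN hN2
  have hN' : (N : ℝ) ≠ 0 := by exact_mod_cast hN.ne'
  have hN2' : (⌊(N : ℝ) * x⌋₊ : ℝ) ≠ 0 := by exact_mod_cast hN2.ne'
  have hN3 : (totientSum N : ℝ) ≠ 0 := by exact_mod_cast (totientSum_pos hN).ne'
  simp only [Function.comp, Pi.div_apply]
  field_simp

/-- Abel summation moves the sum onto `g'` weighted by ratios of totient sums, which tend to `x ^
2`; integrating the limit by parts brings back `g` with weight `2 x`. -/
theorem tendsto_sum_totient_mul {g g' : ℝ → ℂ} (hg : ∀ x, HasDerivAt g (g' x) x)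
    (hg' : Continuous g') :
    Tendsto (fun N : ℕ => (∑ b ∈ range (N + 1), (b.totient : ℂ) * g (b / N)) / totientSum N)
      atTop (𝓝 (∫ x in (0 : ℝ)..1, (2 * x : ℝ) * g x)) := by
  have hlim : ∫ x in (0 : ℝ)..1, ((2 * x : ℝ) : ℂ) * g x =
      g 1 - ∫ x in (0 : ℝ)..1, g' x * ((x ^ 2 : ℝ) : ℂ) := by
    have h1 : ∀ x ∈ Set.uIcc (0 : ℝ) 1,
        HasDerivAt (fun x : ℝ => ((x ^ 2 : ℝ) : ℂ)) ((2 * x : ℝ) : ℂ) x := fun x _ => by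
      have := (hasDerivAt_pow 2 x).ofReal_comp
      simpa using this
    have hgc : Continuous g := continuous_iff_continuousAt.mpr fun x => (hg x).continuousAt
    have := intervalIntegral.integral_deriv_mul_eq_sub (a := 0) (b := 1) h1 (fun x _ => hg x)
      (by apply Continuous.intervalIntegrable; fun_prop) (hg'.intervalIntegrable _ _)
    rw [intervalIntegral.integral_add (by apply Continuous.intervalIntegrable; fun_prop)
      (by apply Continuous.intervalIntegrable; fun_prop)] at this
    simp only [one_pow, Complex.ofReal_one, one_mul, ne_eq, OfNat.ofNat_ne_zero,
      not_false_eq_true, zero_pow, Complex.ofReal_zero, zero_mul, sub_zero] at this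
    rw [eq_sub_iff_add_eq, ← this]
    congr 1
    exact intervalIntegral.integral_congr fun x _ => mul_comm _ _
  rw [hlim]
  have hdct : Tendsto (fun N : ℕ => ∫ x in (0 : ℝ)..1,
      g' x * (((totientSum ⌊(N : ℝ) * x⌋₊ : ℝ) / totientSum N : ℝ) : ℂ)) atTop
      (𝓝 (∫ x in (0 : ℝ)..1, g' x * ((x ^ 2 : ℝ) : ℂ))) := by
    refine intervalIntegral.tendsto_integral_filter_of_dominated_convergence
      (fun x => ‖g' x‖) (Eventually.of_forall fun N => ?_) ?_
      (hg'.norm.intervalIntegrable _ _) ?_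
    · refine (hg'.measurable.mul (Complex.measurable_ofReal.comp (Measurable.div_const ?_ _))).aestronglyMeasurable
      exact (measurable_from_nat (f := fun n => (totientSum n : ℝ))).comp
        (Nat.measurable_floor.comp (measurable_id.const_mul _))
    · refine Eventually.of_forall fun N => Eventually.of_forall fun x hx => ?_
      rw [Set.uIoc_of_le zero_le_one] at hx
      rw [norm_mul, Complex.norm_real, Real.norm_of_nonneg (by positivity)]
      refine mul_le_of_le_one_right (norm_nonneg _) (div_le_one_of_le₀ ?_ (by positivity))
      refine Nat.cast_le.mpr (totientSum_mono ?_)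
      refine Nat.floor_le_of_le ?_
      exact mul_le_of_le_one_right (by positivity) hx.2
    · refine Eventually.of_forall fun x hx => ?_
      rw [Set.uIoc_of_le zero_le_one] at hx
      exact ((Complex.continuous_ofReal.tendsto _).comp
        (tendsto_totientSum_ratio hx.1)).const_mul _
  refine (tendsto_const_nhds.sub hdct).congr' ?_
  filter_upwards [eventually_gt_atTop 0] with N hN
  have hN' : (0 : ℝ) < N := by exact_mod_cast hN
  have hN3 : (totientSum N : ℂ) ≠ 0 := by exact_mod_cast (totientSum_pos hN).ne'
  have hd : ∀ t : ℝ, HasDerivAt (fun t : ℝ => g (t / N)) ((1 / N : ℝ) * g' (t / N)) t := by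
    intro t
    have := (hg (t / N)).scomp t ((hasDerivAt_id t).div_const (N : ℝ))
    simpa [Function.comp_def] using this
  have hsum : ∀ M : ℕ, ∑ k ∈ Icc 0 M, ((k.totient : ℕ) : ℂ) = totientSum M := by
    intro M
    rw [totientSum, Nat.range_succ_eq_Icc_zero, Nat.cast_sum]
  have habel := sum_mul_eq_sub_integral_mul (fun n => (n.totient : ℂ)) (f := fun t => g (t / N))
    hN'.le (fun t _ => (hd t).differentiableAt) (by
      have : deriv (fun t : ℝ => g (t / N)) = fun t => ((1 / N : ℝ) : ℂ) * g' (t / N) :=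
        funext fun t => (hd t).deriv
      rw [this]
      apply Continuous.integrableOn_Icc
      fun_prop)
  simp only [hsum, Nat.floor_natCast, fun t => (hd t).deriv, div_self hN'.ne'] at habel
  rw [← intervalIntegral.integral_of_le hN'.le] at habel
  have hcv : ∫ t in (0 : ℝ)..N, ((1 / N : ℝ) : ℂ) * g' (t / N) * (totientSum ⌊t⌋₊ : ℂ) =
      ∫ x in (0 : ℝ)..1, g' x * (totientSum ⌊(N : ℝ) * x⌋₊ : ℂ) := by
    have := intervalIntegral.integral_comp_div (a := 0) (b := N)
      (fun x : ℝ => g' x * (totientSum ⌊(N : ℝ) * x⌋₊ : ℂ)) hN'.ne'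
    rw [zero_div, div_self hN'.ne'] at this
    have h2 : ∀ t : ℝ, (N : ℝ) * (t / N) = t := fun t => by field_simp
    simp only [h2] at this
    simp only [mul_assoc]
    rw [intervalIntegral.integral_const_mul, this]
    rw [Complex.real_smul, ← mul_assoc, ← Complex.ofReal_mul, one_div_mul_cancel hN'.ne']
    simp
  rw [hcv] at habel
  rw [Nat.range_succ_eq_Icc_zero]
  simp only [mul_comm ((Nat.totient _ : ℕ) : ℂ)]
  rw [habel, sub_div, mul_div_cancel_right₀ _ hN3, ← intervalIntegral.integral_div]
  congr 2
  ext x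
  push_cast
  ring

end TotientSum

/-! ### Equidistribution of residues together with their inverses -/

section Equidistribution

open Finset

/-- The reduced residues `r` modulo `b`, for all moduli `b ≤ N`. -/
def pairs (N : ℕ) : Finset (ℕ × ℕ) :=
  {p ∈ range (N + 1) ×ˢ range (N + 1) | p.2 < p.1 ∧ p.1.Coprime p.2}

theorem mem_pairs {N : ℕ} {p : ℕ × ℕ} :
    p ∈ pairs N ↔ p.1 ≤ N ∧ p.2 < p.1 ∧ p.1.Coprime p.2 := by
  simp only [pairs, mem_filter, mem_product, mem_range]
  refine ⟨fun h => ⟨by omega, h.2⟩, fun h => ⟨⟨by omega, by omega⟩, h.2⟩⟩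

theorem sum_pairs {M : Type*} [AddCommMonoid M] (N : ℕ) (f : ℕ × ℕ → M) :
    ∑ p ∈ pairs N, f p = ∑ b ∈ range (N + 1), ∑ r ∈ range b with b.Coprime r, f (b, r) := by
  rw [pairs, sum_filter, sum_product]
  refine sum_congr rfl fun b hb => ?_
  rw [← sum_filter]
  refine sum_congr ?_ fun _ _ => rfl
  ext r
  simp only [mem_filter, mem_range] at hb ⊢
  exact ⟨fun h => h.2, fun h => ⟨by omega, h⟩⟩

theorem card_pairs (N : ℕ) : #(pairs N) = totientSum N := by
  rw [card_eq_sum_ones, sum_pairs, totientSum]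
  refine sum_congr rfl fun b _ => ?_
  rw [← card_eq_sum_ones]
  rfl

/-- The rescaled point attached to a modulus `b`, a residue `r` and the inverse of `r`. -/
noncomputable def point (N : ℕ) (p : ℕ × ℕ) : ℝ × ℝ × ℝ :=
  ((p.1 : ℝ) / N, (p.2 : ℝ) / p.1, (modInv p.1 p.2 : ℝ) / p.1)

/-- The measure `2 x dx` on the unit interval. -/
noncomputable def radial : Measure ℝ :=
  (volume.restrict (Set.Ioo 0 1)).withDensity fun x => ENNReal.ofReal (2 * x)

/-- The measure `2 x dx du dv` on the unit cube. -/
noncomputable def cubeMeasure : Measure (ℝ × ℝ × ℝ) :=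
  radial.prod ((volume.restrict (Set.Ioo 0 1)).prod (volume.restrict (Set.Ioo 0 1)))

instance : IsProbabilityMeasure (volume.restrict (Set.Ioo (0 : ℝ) 1)) := ⟨by simp⟩

theorem integral_radial (g : ℝ → ℂ) :
    ∫ x, g x ∂radial = ∫ x in (0 : ℝ)..1, (2 * x : ℝ) * g x := by
  rw [radial, integral_withDensity_eq_integral_toReal_smul (by fun_prop)
      (Eventually.of_forall fun _ => ENNReal.ofReal_lt_top),
    intervalIntegral.integral_of_le zero_le_one, integral_Ioc_eq_integral_Ioo]
  refine setIntegral_congr_fun measurableSet_Ioo fun x hx => ?_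
  rw [ENNReal.toReal_ofReal (by linarith [hx.1]), Complex.real_smul]

instance : IsProbabilityMeasure radial := by
  refine ⟨?_⟩
  have h : ∫ x in (0 : ℝ)..1, 2 * x = 1 := by
    rw [intervalIntegral.integral_const_mul, integral_id]; norm_num
  rw [radial, withDensity_apply _ MeasurableSet.univ, Measure.restrict_univ,
    ← ofReal_integral_eq_lintegral_ofReal, ← integral_Ioc_eq_integral_Ioo,
    ← intervalIntegral.integral_of_le zero_le_one, h, ENNReal.ofReal_one]
  · exact ((continuous_const.mul continuous_id).integrableOn_Icc (a := (0 : ℝ)) (b := 1)).mono_set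
      Set.Ioo_subset_Icc_self
  · rw [EventuallyLE, ae_restrict_iff' measurableSet_Ioo]
    exact Eventually.of_forall fun x hx => by simpa using hx.1.le

instance : IsProbabilityMeasure cubeMeasure := by unfold cubeMeasure; infer_instance

/-- The uniform distribution on the points attached to `pairs N`. -/
noncomputable def empirical (N : ℕ) : Measure (ℝ × ℝ × ℝ) :=
  (totientSum N : ENNReal)⁻¹ • ∑ p ∈ pairs N, Measure.dirac (point N p)

theorem isProbabilityMeasure_empirical {N : ℕ} (hN : 0 < N) :
    IsProbabilityMeasure (empirical N) := by
  refine ⟨?_⟩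
  simp only [empirical, Measure.smul_apply, Measure.finsetSum_apply, measure_univ, sum_const,
    card_pairs, nsmul_eq_mul, mul_one, smul_eq_mul]
  exact ENNReal.inv_mul_cancel (by exact_mod_cast (totientSum_pos hN).ne') (by simp)

theorem integral_empirical (N : ℕ) (f : ℝ × ℝ × ℝ → ℂ) :
    ∫ x, f x ∂empirical N = (∑ p ∈ pairs N, f (point N p)) / totientSum N := by
  rw [empirical, integral_smul_measure, integral_finsetSum_measure]
  · simp only [integral_dirac]
    rw [Complex.real_smul, ENNReal.toReal_inv, ENNReal.toReal_natCast, div_eq_inv_mul]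
    simp
  · exact fun p _ => integrable_dirac (by simp)

open Classical in
theorem empirical_apply (N : ℕ) (E : Set (ℝ × ℝ × ℝ)) (hE : MeasurableSet E) :
    (empirical N E).toReal = (#{p ∈ pairs N | point N p ∈ E} : ℝ) / totientSum N := by
  simp only [empirical, Measure.smul_apply, Measure.finsetSum_apply, smul_eq_mul,
    Measure.dirac_apply' _ hE, ENNReal.toReal_mul, ENNReal.toReal_inv, ENNReal.toReal_natCast]
  rw [div_eq_inv_mul, card_filter]
  congr 1
  rw [ENNReal.toReal_sum (fun p _ => by unfold Set.indicator; split_ifs <;> simp)]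
  push_cast
  refine sum_congr rfl fun p _ => ?_
  by_cases h : point N p ∈ E <;> simp [h]

/-- The character of frequency `k` on the line. -/
noncomputable def char (k : ℤ) (x : ℝ) : ℂ := Complex.exp (2 * Real.pi * Complex.I * k * x)

theorem hasDerivAt_char (k : ℤ) (x : ℝ) :
    HasDerivAt (char k) (2 * Real.pi * Complex.I * k * char k x) x := by
  have h := ((hasDerivAt_id (x : ℂ)).const_mul (2 * Real.pi * Complex.I * k)).cexp.comp_ofReal
  simp only [id, mul_one] at h
  rw [mul_comm]
  exact h

theorem continuous_char (k : ℤ) : Continuous (char k) :=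
  continuous_iff_continuousAt.mpr fun x => (hasDerivAt_char k x).continuousAt

theorem norm_char (k : ℤ) (x : ℝ) : ‖char k x‖ = 1 := by
  have : 2 * Real.pi * Complex.I * k * x = ((2 * Real.pi * k * x : ℝ) : ℂ) * Complex.I := by
    push_cast; ring
  rw [char, this, Complex.norm_exp_ofReal_mul_I]

theorem char_zero (x : ℝ) : char 0 x = 1 := by simp [char]

theorem integral_char {k : ℤ} (hk : k ≠ 0) : ∫ x in Set.Ioo (0 : ℝ) 1, char k x = 0 := by
  have hc : (2 * Real.pi * Complex.I * k : ℂ) ≠ 0 := by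
    have := Complex.two_pi_I_ne_zero
    have hk' : (k : ℂ) ≠ 0 := by exact_mod_cast hk
    exact mul_ne_zero this hk'
  rw [← integral_Ioc_eq_integral_Ioo, ← intervalIntegral.integral_of_le zero_le_one]
  simp only [char]
  rw [integral_exp_mul_complex hc]
  have : (2 * Real.pi * Complex.I * k * (1 : ℝ) : ℂ) = k * (2 * Real.pi * Complex.I) := by
    push_cast; ring
  rw [this, Complex.exp_int_mul_two_pi_mul_I]
  simp

theorem sum_pairs_char (N : ℕ) (k m n : ℤ) :
    ∑ p ∈ pairs N, char k (point N p).1 * (char m (point N p).2.1 * char n (point N p).2.2) =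
      ∑ b ∈ range (N + 1), char k (b / N) * expSum m n b := by
  rw [sum_pairs]
  refine sum_congr rfl fun b _ => ?_
  rw [expSum, mul_sum]
  refine sum_congr rfl fun r _ => ?_
  simp only [point, char]
  rw [← Complex.exp_add, ← Complex.exp_add, ← Complex.exp_add]
  congr 1
  push_cast
  ring

/-- Weyl's criterion. For `m = n = 0` this is the totient average of `char k`; otherwise the limit
is zero and the Kloosterman sums supply the cancellation. -/
theorem tendsto_integral_char (k m n : ℤ) :
    Tendsto (fun N => ∫ x, char k x.1 * (char m x.2.1 * char n x.2.2) ∂empirical N) atTop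
      (𝓝 (∫ x, char k x.1 * (char m x.2.1 * char n x.2.2) ∂cubeMeasure)) := by
  simp only [integral_empirical, sum_pairs_char]
  rw [cubeMeasure, integral_prod_mul (char k) (fun y : ℝ × ℝ => char m y.1 * char n y.2),
    integral_prod_mul (char m) (char n), integral_radial]
  by_cases h : m = 0 ∧ n = 0
  · obtain ⟨rfl, rfl⟩ := h
    have h0 : ∀ b, expSum 0 0 b = b.totient := by
      intro b
      simp [expSum, Nat.totient]
    simp only [h0, char_zero, integral_const, probReal_univ, one_smul, mul_one]
    have := tendsto_sum_totient_mul (hasDerivAt_char k)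
      (continuous_const.mul (continuous_char k))
    refine this.congr fun N => ?_
    congr 1
    exact sum_congr rfl fun b _ => mul_comm _ _
  · have hzero : (∫ x in Set.Ioo (0 : ℝ) 1, char m x) * ∫ x in Set.Ioo (0 : ℝ) 1, char n x = 0 := by
      rw [not_and_or] at h
      rcases h with h | h <;> simp [integral_char h]
    rw [hzero, mul_zero]
    have ho : (fun N : ℕ => ∑ b ∈ range N, ‖expSum m n b‖) =o[atTop]
        fun N => ∑ b ∈ range N, (b.totient : ℝ) := by
      refine Asymptotics.IsLittleO.sum_range
        (isLittleO_expSum (not_and_or.mp h)).norm_left (fun b => Nat.cast_nonneg _) ?_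
      rw [← tendsto_add_atTop_iff_nat 1]
      refine tendsto_totientSum_atTop.congr fun N => ?_
      simp [totientSum]
    have ho' := ((ho.comp_tendsto (tendsto_add_atTop_nat 1)).tendsto_div_nhds_zero)
    refine squeeze_zero_norm (fun N => ?_) ho'
    simp only [Function.comp_apply]
    rw [norm_div, Complex.norm_natCast]
    have : ((totientSum N : ℕ) : ℝ) = ∑ b ∈ range (N + 1), (b.totient : ℝ) := by
      simp [totientSum]
    rw [this]
    gcongr
    refine (norm_sum_le _ _).trans (sum_le_sum fun b _ => ?_)
    rw [norm_mul, norm_char, one_mul]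

/-- The projection of space onto the three-dimensional torus. -/
def toTorus (x : ℝ × ℝ × ℝ) : UnitAddTorus (Fin 3) :=
  Pi.map (fun _ => ((↑) : ℝ → UnitAddCircle)) ![x.1, x.2.1, x.2.2]

theorem continuous_vec : Continuous fun x : ℝ × ℝ × ℝ => ![x.1, x.2.1, x.2.2] := by
  fun_prop

theorem continuous_toTorus : Continuous toTorus := by
  refine continuous_pi fun i => (AddCircle.continuous_mk' 1).comp ?_
  exact (continuous_apply i).comp continuous_vec

/-- Carries open subsets of the cube to open subsets of the torus, where weak convergence is
available. -/
theorem isOpenMap_toTorus : IsOpenMap toTorus := by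
  have h1 : IsOpenMap fun x : ℝ × ℝ × ℝ => ![x.1, x.2.1, x.2.2] := by
    intro G hG
    have : (fun x : ℝ × ℝ × ℝ => ![x.1, x.2.1, x.2.2]) '' G =
        (fun f : Fin 3 → ℝ => (f 0, f 1, f 2)) ⁻¹' G := by
      ext f
      constructor
      · rintro ⟨x, hx, rfl⟩
        exact hx
      · intro hf
        refine ⟨_, hf, ?_⟩
        ext i
        fin_cases i <;> rfl
    rw [this]
    exact hG.preimage (by fun_prop)
  exact (IsOpenMap.piMap (fun _ => QuotientAddGroup.isOpenMap_coe) (by simp)).comp h1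

theorem mFourier_toTorus (k : Fin 3 → ℤ) (x : ℝ × ℝ × ℝ) :
    UnitAddTorus.mFourier k (toTorus x) =
      char (k 0) x.1 * (char (k 1) x.2.1 * char (k 2) x.2.2) := by
  simp only [UnitAddTorus.mFourier, ContinuousMap.coe_mk, Fin.prod_univ_three, toTorus, Pi.map,
    char]
  simp [mul_assoc]

theorem integrable_comp_toTorus (μ : Measure (ℝ × ℝ × ℝ)) [IsProbabilityMeasure μ]
    (F : C(UnitAddTorus (Fin 3), ℂ)) : Integrable (fun x => F (toTorus x)) μ :=
  Integrable.of_bound (F.continuous.comp continuous_toTorus).aestronglyMeasurable ‖F‖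
    (Eventually.of_forall fun _ => F.norm_coe_le_norm _)

theorem norm_integral_comp_toTorus_sub_le (μ : Measure (ℝ × ℝ × ℝ)) [IsProbabilityMeasure μ]
    (F G : C(UnitAddTorus (Fin 3), ℂ)) :
    ‖(∫ x, F (toTorus x) ∂μ) - ∫ x, G (toTorus x) ∂μ‖ ≤ ‖F - G‖ := by
  rw [← integral_sub (integrable_comp_toTorus μ F) (integrable_comp_toTorus μ G)]
  have := norm_integral_le_of_norm_le_const (μ := μ) (f := fun x => F (toTorus x) - G (toTorus x))
    (Eventually.of_forall fun x => (F - G).norm_coe_le_norm (toTorus x))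
  simpa using this

/-- Trigonometric polynomials are uniformly dense. The index `N + 1` avoids level `0`, where
`empirical` vanishes and is not a probability measure. -/
theorem tendsto_integral_toTorus (F : C(UnitAddTorus (Fin 3), ℂ)) :
    Tendsto (fun N => ∫ x, F (toTorus x) ∂empirical (N + 1)) atTop
      (𝓝 (∫ x, F (toTorus x) ∂cubeMeasure)) := by
  have hp : ∀ N, IsProbabilityMeasure (empirical (N + 1)) := fun N =>
    isProbabilityMeasure_empirical N.succ_pos
  have hspan : ∀ G ∈ Submodule.span ℂ (Set.range (UnitAddTorus.mFourier (d := Fin 3))),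
      Tendsto (fun N => ∫ x, G (toTorus x) ∂empirical (N + 1)) atTop
        (𝓝 (∫ x, G (toTorus x) ∂cubeMeasure)) := by
    intro G hG
    induction hG using Submodule.span_induction with
    | mem G hG =>
      obtain ⟨k, rfl⟩ := hG
      simp only [mFourier_toTorus]
      exact (tendsto_integral_char (k 0) (k 1) (k 2)).comp (tendsto_add_atTop_nat 1)
    | zero => simp
    | add G G' _ _ h h' =>
      simp only [ContinuousMap.add_apply]
      rw [integral_add (integrable_comp_toTorus _ G) (integrable_comp_toTorus _ G')]
      refine (h.add h').congr fun N => ?_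
      rw [integral_add (integrable_comp_toTorus _ G) (integrable_comp_toTorus _ G')]
    | smul c G _ h =>
      simp only [ContinuousMap.smul_apply, integral_smul]
      exact h.const_smul c
  rw [Metric.tendsto_atTop]
  intro ε hε
  have hF : F ∈ (Submodule.span ℂ
      (Set.range (UnitAddTorus.mFourier (d := Fin 3)))).topologicalClosure := by
    rw [UnitAddTorus.span_mFourier_closure_eq_top]; trivial
  obtain ⟨G, hG, hFG⟩ := Metric.mem_closure_iff.mp hF (ε / 3) (by positivity)
  obtain ⟨N₀, hN₀⟩ := Metric.tendsto_atTop.mp (hspan G hG) (ε / 3) (by positivity)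
  refine ⟨N₀, fun N hN => ?_⟩
  have h1 := norm_integral_comp_toTorus_sub_le (empirical (N + 1)) F G
  have h2 := norm_integral_comp_toTorus_sub_le cubeMeasure F G
  have h3 := hN₀ N hN
  rw [dist_eq_norm] at hFG h3 ⊢
  set A := ∫ x, F (toTorus x) ∂empirical (N + 1)
  set B := ∫ x, F (toTorus x) ∂cubeMeasure
  set A' := ∫ x, G (toTorus x) ∂empirical (N + 1)
  set B' := ∫ x, G (toTorus x) ∂cubeMeasure
  calc ‖A - B‖ = ‖(A - A') + (A' - B') - (B - B')‖ := by congr 1; ring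
    _ ≤ ‖A - A'‖ + ‖A' - B'‖ + ‖B - B'‖ := (norm_sub_le _ _).trans (by gcongr; exact norm_add_le _ _)
    _ < ε := by linarith

/-- The difference is an integer of absolute value below `1`. End points are allowed for `y` because
the residue `0` modulo `1` gives a point on the boundary of the cube. -/
theorem eq_of_coe_eq_coe {x y : ℝ} (hx : x ∈ Set.Ioo (0 : ℝ) 1) (hy : y ∈ Set.Icc (0 : ℝ) 1)
    (h : (x : UnitAddCircle) = y) : x = y := by
  rw [QuotientAddGroup.eq, AddSubgroup.mem_zmultiples_iff] at h
  obtain ⟨k, hk⟩ := h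
  rw [zsmul_eq_mul, mul_one] at hk
  have h1 : (k : ℝ) < 1 := by linarith [hx.1, hy.2]
  have h2 : (-1 : ℝ) < k := by linarith [hx.2, hy.1]
  have h3 : k = 0 := by
    have h1' : k < 1 := by exact_mod_cast h1
    have h2' : -1 < k := by exact_mod_cast h2
    omega
  rw [h3] at hk
  push_cast at hk
  linarith

theorem modInv_lt {b : ℕ} (hb : 0 < b) (r : ℕ) : modInv b r < b := by
  have : NeZero b := ⟨hb.ne'⟩
  exact ZMod.val_lt _

theorem point_mem_Icc {N : ℕ} {p : ℕ × ℕ} (hp : p ∈ pairs N) :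
    (point N p).1 ∈ Set.Icc (0 : ℝ) 1 ∧ (point N p).2.1 ∈ Set.Icc (0 : ℝ) 1 ∧
      (point N p).2.2 ∈ Set.Icc (0 : ℝ) 1 := by
  obtain ⟨h1, h2, -⟩ := mem_pairs.mp hp
  have h3 := (modInv_lt (by omega : 0 < p.1) p.2).le
  refine ⟨⟨by simp only [point]; positivity, div_le_one_of_le₀ ?_ (by positivity)⟩,
    ⟨by simp only [point]; positivity, div_le_one_of_le₀ ?_ (by positivity)⟩,
    ⟨by simp only [point]; positivity, div_le_one_of_le₀ ?_ (by positivity)⟩⟩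
  · exact_mod_cast h1
  · exact_mod_cast h2.le
  · exact_mod_cast h3

/-- The portmanteau inequality on the torus, applied to the image of `G ∩ C` with `C` the open cube.
Nothing is lost in the limit, as the complement of `C` is null; and an attached point, which lies in
the closed cube, falls over that image only if it is itself in `G`. -/
theorem le_liminf_empirical {G : Set (ℝ × ℝ × ℝ)} (hG : IsOpen G) :
    cubeMeasure G ≤ liminf (fun N => empirical (N + 1) G) atTop := by
  have hp : ∀ N, IsProbabilityMeasure (empirical (N + 1)) := fun N =>
    isProbabilityMeasure_empirical N.succ_pos
  have hm := continuous_toTorus.measurable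
  let μ : ProbabilityMeasure (UnitAddTorus (Fin 3)) :=
    ⟨cubeMeasure.map toTorus, Measure.isProbabilityMeasure_map hm.aemeasurable⟩
  let μs : ℕ → ProbabilityMeasure (UnitAddTorus (Fin 3)) := fun N =>
    ⟨(empirical (N + 1)).map toTorus, Measure.isProbabilityMeasure_map hm.aemeasurable⟩
  have hlim : Tendsto μs atTop (𝓝 μ) := by
    rw [ProbabilityMeasure.tendsto_iff_forall_integral_rclike_tendsto ℂ]
    intro f
    simp only [μ, μs, ProbabilityMeasure.coe_mk]
    rw [integral_map hm.aemeasurable f.continuous.aestronglyMeasurable]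
    refine (tendsto_integral_toTorus f.toContinuousMap).congr fun N => ?_
    rw [integral_map hm.aemeasurable f.continuous.aestronglyMeasurable]
    rfl
  let C : Set (ℝ × ℝ × ℝ) := Set.Ioo 0 1 ×ˢ (Set.Ioo 0 1 ×ˢ Set.Ioo 0 1)
  have hC : IsOpen C := isOpen_Ioo.prod (isOpen_Ioo.prod isOpen_Ioo)
  have hU : IsOpen (toTorus '' (G ∩ C)) := isOpenMap_toTorus _ (hG.inter hC)
  have key := ProbabilityMeasure.le_liminf_measure_open_of_tendsto hlim hU
  simp only [μ, μs, ProbabilityMeasure.coe_mk, Measure.map_apply hm hU.measurableSet] at key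
  have h1 : cubeMeasure G ≤ cubeMeasure (toTorus ⁻¹' (toTorus '' (G ∩ C))) := by
    have hCc : cubeMeasure Cᶜ = 0 := by
      rw [prob_compl_eq_zero_iff hC.measurableSet]
      simp only [cubeMeasure, C, Measure.prod_prod]
      have : radial (Set.Ioo 0 1) = 1 := by
        rw [← measure_univ (μ := radial), radial, withDensity_apply _ measurableSet_Ioo,
          withDensity_apply _ MeasurableSet.univ, Measure.restrict_restrict measurableSet_Ioo,
          Set.inter_self, Measure.restrict_univ]
      rw [this]
      simp
    calc cubeMeasure G ≤ cubeMeasure (G ∩ C) + cubeMeasure (G \ C) := measure_le_inter_add_sdiff _ _ _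
      _ ≤ cubeMeasure (G ∩ C) + cubeMeasure Cᶜ := by gcongr; exact fun x hx => hx.2
      _ = cubeMeasure (G ∩ C) := by rw [hCc, add_zero]
      _ ≤ _ := measure_mono (Set.subset_preimage_image _ _)
  refine h1.trans (key.trans (liminf_le_liminf (Eventually.of_forall fun N => ?_)))
  rw [empirical, Measure.smul_apply, Measure.smul_apply, Measure.finsetSum_apply,
    Measure.finsetSum_apply]
  refine mul_le_mul_right ?_ _
  refine sum_le_sum fun p hp => ?_
  rw [Measure.dirac_apply' _ (hm hU.measurableSet), Measure.dirac_apply' _ hG.measurableSet]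
  by_cases h : point (N + 1) p ∈ toTorus ⁻¹' (toTorus '' (G ∩ C))
  · have hGp : point (N + 1) p ∈ G := by
      obtain ⟨x, ⟨hxG, hx1, hx2, hx3⟩, hx⟩ := h
      obtain ⟨hp1, hp2, hp3⟩ := point_mem_Icc hp
      have e : ∀ i, _ := fun i => congrFun hx i
      have e1 := eq_of_coe_eq_coe hx1 hp1 (e 0)
      have e2 := eq_of_coe_eq_coe hx2 hp2 (e 1)
      have e3 := eq_of_coe_eq_coe hx3 hp3 (e 2)
      have : point (N + 1) p = x := Prod.ext e1.symm (Prod.ext e2.symm e3.symm)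
      rwa [this]
    rw [Set.indicator_of_mem h, Set.indicator_of_mem hGp]
  · rw [Set.indicator_of_notMem h]
    exact zero_le

theorem tendsto_empirical {E : Set (ℝ × ℝ × ℝ)} (hE : cubeMeasure (frontier E) = 0) :
    Tendsto (fun N => empirical (N + 1) E) atTop (𝓝 (cubeMeasure E)) := by
  have hp : ∀ N, IsProbabilityMeasure (empirical (N + 1)) := fun N =>
    isProbabilityMeasure_empirical N.succ_pos
  exact tendsto_measure_of_null_frontier (fun G hG => le_liminf_empirical hG) hE

end Equidistribution

/-! ### The limiting density of saturated pairs -/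

section LimitFormula

/-- The map from the cube to the cone of triples `(b, r, r⁻¹) / N`. -/
def homog (x : ℝ × ℝ × ℝ) : ℝ × ℝ × ℝ := (x.1, x.1 * x.2.1, x.1 * x.2.2)

theorem continuous_homog : Continuous homog := by unfold homog; fun_prop

/-- The density of the image of `cubeMeasure` under `homog`. -/
noncomputable def coneDensity (x : ℝ × ℝ × ℝ) : ENNReal :=
  if x.1 ∈ Set.Ioo (0 : ℝ) 1 ∧ x.2.1 ∈ Set.Ioo 0 x.1 ∧ x.2.2 ∈ Set.Ioo 0 x.1 then
    ENNReal.ofReal (2 / x.1) else 0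

theorem measurable_coneDensity : Measurable coneDensity := by
  refine Measurable.ite ?_ (by fun_prop) measurable_const
  have h : ∀ f : ℝ × ℝ × ℝ → ℝ, Measurable f → MeasurableSet {x | f x ∈ Set.Ioo 0 x.1} :=
    fun f hf => (measurableSet_lt measurable_const hf).inter (measurableSet_lt hf measurable_fst)
  exact (measurable_fst measurableSet_Ioo).inter ((h (fun x => x.2.1) (by fun_prop)).inter
    (h (fun x => x.2.2) (by fun_prop)))

/-- For fixed `x` the map dilates the other two coordinates by `x`; its Jacobian `x ^ 2` turns the
density `2 x` into `2 / x`. -/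
theorem map_homog_cubeMeasure : cubeMeasure.map homog = volume.withDensity coneDensity := by
  refine Measure.ext fun S hS => ?_
  have hm := continuous_homog.measurable
  rw [Measure.map_apply hm hS, withDensity_apply _ hS, cubeMeasure,
    Measure.prod_apply (hm hS), ← lintegral_indicator hS, Measure.volume_eq_prod,
    lintegral_prod _ (measurable_coneDensity.indicator hS).aemeasurable, radial,
    lintegral_withDensity_eq_lintegral_mul _ (by fun_prop) (measurable_measure_prodMk_left (hm hS)),
    ← lintegral_indicator measurableSet_Ioo]
  refine lintegral_congr fun x => ?_
  by_cases hx : x ∈ Set.Ioo (0 : ℝ) 1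
  · rw [Set.indicator_of_mem hx, Pi.mul_apply]
    have hx0 : 0 < x := hx.1
    set W : Set (ℝ × ℝ) := Prod.mk x ⁻¹' S ∩ (Set.Ioo 0 x ×ˢ Set.Ioo 0 x) with hW
    have hWm : MeasurableSet W :=
      (measurable_prodMk_left hS).inter (measurableSet_Ioo.prod measurableSet_Ioo)
    have h1 : ∀ q : ℝ × ℝ, S.indicator coneDensity (x, q) =
        W.indicator (fun _ => ENNReal.ofReal (2 / x)) q := by
      intro q
      by_cases hq : (x, q) ∈ S
      · rw [Set.indicator_of_mem hq, coneDensity]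
        by_cases hq2 : q ∈ Set.Ioo 0 x ×ˢ Set.Ioo 0 x
        · rw [if_pos ⟨hx, hq2⟩, Set.indicator_of_mem (show q ∈ W from ⟨hq, hq2⟩)]
        · rw [if_neg fun h => hq2 h.2, Set.indicator_of_notMem fun h => hq2 h.2]
      · rw [Set.indicator_of_notMem hq, Set.indicator_of_notMem fun h => hq h.1]
    simp only [h1]
    rw [lintegral_indicator_const hWm, Measure.prod_restrict,
      Measure.restrict_apply (measurable_prodMk_left (hm hS))]
    have h2 : Prod.mk x ⁻¹' (homog ⁻¹' S) ∩ Set.Ioo 0 1 ×ˢ Set.Ioo 0 1 =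
        (fun q : ℝ × ℝ => x • q) ⁻¹' W := by
      ext ⟨u, v⟩
      simp only [homog, hW, Set.mem_inter_iff, Set.mem_preimage, Set.mem_prod, Set.mem_Ioo,
        Prod.smul_mk, smul_eq_mul, mul_pos_iff_of_pos_left hx0, mul_lt_iff_lt_one_right hx0]
    rw [h2, ← Measure.volume_eq_prod, Measure.addHaar_preimage_smul _ hx0.ne', ← mul_assoc,
      ← ENNReal.ofReal_mul (by positivity)]
    congr 2
    rw [abs_of_nonneg (by positivity)]
    simp only [Module.finrank_prod, Module.finrank_self]
    field_simp
  · rw [Set.indicator_of_notMem hx]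
    have h : ∀ q : ℝ × ℝ, S.indicator coneDensity (x, q) = 0 := by
      intro q
      have : coneDensity (x, q) = 0 := if_neg fun h => hx h.1
      by_cases hq : (x, q) ∈ S <;> simp [hq, this]
    simp only [h, lintegral_zero]

/-- The limiting density of the pairs `(b, r) / N` with `b + r + r⁻¹ ≤ N`. -/
noncomputable def weight (p : ℝ × ℝ) : ℝ :=
  if 0 < p.2 ∧ p.2 < p.1 then 2 * max 0 (min 1 ((1 - p.1 - p.2) / p.1)) else 0

theorem weight_nonneg (p : ℝ × ℝ) : 0 ≤ weight p := by
  unfold weight; split_ifs <;> positivity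

theorem measurable_weight : Measurable weight := by
  refine Measurable.ite ?_ (by fun_prop) measurable_const
  exact (measurableSet_lt measurable_const measurable_snd).inter
    (measurableSet_lt measurable_snd measurable_fst)

/-- The cone over a planar set `B`, cut off by `x + y + z ≤ 1`. -/
def truncatedCone (B : Set (ℝ × ℝ)) : Set (ℝ × ℝ × ℝ) :=
  {x | 0 < x.2.1 ∧ x.1 + x.2.1 + x.2.2 ≤ 1 ∧ (x.1, x.2.1) ∈ B}

theorem measurableSet_truncatedCone {B : Set (ℝ × ℝ)} (hB : MeasurableSet B) :
    MeasurableSet (truncatedCone B) := by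
  have h : Measurable fun x : ℝ × ℝ × ℝ => (x.1, x.2.1) := by fun_prop
  exact (measurableSet_lt (g := fun x : ℝ × ℝ × ℝ => x.2.1) measurable_const
    (by fun_prop)).inter ((measurableSet_le (f := fun x : ℝ × ℝ × ℝ => x.1 + x.2.1 + x.2.2)
      (by fun_prop) measurable_const).inter (h hB))

theorem convex_truncatedCone {B : Set (ℝ × ℝ)} (hB : Convex ℝ B) :
    Convex ℝ (truncatedCone B) := by
  rintro x ⟨h1, h2, h3⟩ y ⟨h1', h2', h3'⟩ a b ha hb hab
  refine ⟨?_, ?_, hB h3 h3' ha hb hab⟩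
  · simp only [Prod.snd_add, Prod.fst_add, Prod.smul_snd, Prod.smul_fst, smul_eq_mul]
    rcases ha.eq_or_lt with rfl | ha
    · obtain rfl : b = 1 := by linarith
      simpa using h1'
    · have := mul_pos ha h1
      have := mul_nonneg hb h1'.le
      linarith
  · simp only [Prod.snd_add, Prod.fst_add, Prod.smul_snd, Prod.smul_fst, smul_eq_mul]
    calc _ = a * (x.1 + x.2.1 + x.2.2) + b * (y.1 + y.2.1 + y.2.2) := by ring
      _ ≤ a * 1 + b * 1 := by gcongr
      _ = 1 := by linarith

/-- Integrating out the third coordinate: at `(x, y)` it ranges over an interval of length `min x (1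
- x - y)`, empty if this is negative, with density `2 / x`. -/
theorem cubeMeasure_truncatedCone {B : Set (ℝ × ℝ)} (hB : MeasurableSet B) :
    cubeMeasure (homog ⁻¹' truncatedCone B) = ∫⁻ p in B, ENNReal.ofReal (weight p) := by
  have hS := measurableSet_truncatedCone hB
  rw [← Measure.map_apply continuous_homog.measurable hS, map_homog_cubeMeasure,
    withDensity_apply _ hS, ← lintegral_indicator hS, ← lintegral_indicator hB,
    Measure.volume_eq_prod, Measure.volume_eq_prod,
    lintegral_prod _ (measurable_coneDensity.indicator hS).aemeasurable,
    lintegral_prod _ (measurable_weight.ennreal_ofReal.indicator hB).aemeasurable]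
  refine lintegral_congr fun x => ?_
  rw [lintegral_prod (fun q => (truncatedCone B).indicator coneDensity (x, q))
    ((measurable_coneDensity.indicator hS).comp measurable_prodMk_left).aemeasurable]
  refine lintegral_congr fun y => ?_
  by_cases h : 0 < y ∧ y < x ∧ (x, y) ∈ B
  · obtain ⟨hy, hyx, hyB⟩ := h
    have hx : 0 < x := hy.trans hyx
    have h1 : ∀ w, (truncatedCone B).indicator coneDensity (x, y, w) =
        (Set.Ioo 0 x ∩ Set.Iic (1 - x - y)).indicator (fun _ => ENNReal.ofReal (2 / x)) w := by
      intro w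
      by_cases hw : w ∈ Set.Ioo 0 x ∩ Set.Iic (1 - x - y)
      · have hw' : w ≤ 1 - x - y := hw.2
        have hw0 : 0 < w := hw.1.1
        rw [Set.indicator_of_mem hw, Set.indicator_of_mem, coneDensity, if_pos]
        · exact ⟨⟨hx, by linarith⟩, ⟨hy, hyx⟩, hw.1⟩
        · exact ⟨hy, by simp only; linarith, hyB⟩
      · rw [Set.indicator_of_notMem hw]
        by_cases hc : (x, y, w) ∈ truncatedCone B
        · rw [Set.indicator_of_mem hc, coneDensity, if_neg]
          rintro ⟨-, -, h3⟩
          have := hc.2.1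
          simp only at this
          exact hw ⟨h3, by simp only [Set.mem_Iic]; linarith⟩
        · rw [Set.indicator_of_notMem hc]
    simp only [h1]
    rw [lintegral_indicator_const (measurableSet_Ioo.inter measurableSet_Iic),
      Set.indicator_of_mem hyB, weight, if_pos (show 0 < y ∧ y < x from ⟨hy, hyx⟩)]
    have h2 : volume (Set.Ioo 0 x ∩ Set.Iic (1 - x - y)) =
        ENNReal.ofReal (min x (1 - x - y)) := by
      refine le_antisymm ?_ ?_
      · calc _ ≤ volume (Set.Ioc 0 (min x (1 - x - y))) :=
              measure_mono fun w hw => by exact ⟨hw.1.1, le_min hw.1.2.le hw.2⟩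
          _ = _ := by simp
      · calc _ = volume (Set.Ioo 0 (min x (1 - x - y))) := by simp
          _ ≤ _ := measure_mono fun w hw => by
            exact ⟨⟨hw.1, hw.2.trans_le (min_le_left _ _)⟩, (hw.2.trans_le (min_le_right _ _)).le⟩
    rw [h2, ← ENNReal.ofReal_mul (by positivity)]
    have h3 : min 1 ((1 - x - y) / x) = min x (1 - x - y) / x := by
      rw [← min_div_div_right hx.le, div_self hx.ne']
    rw [h3]
    rcases le_total 0 (min x (1 - x - y)) with h0 | h0
    · rw [max_eq_right (by positivity)]
      congr 1
      field_simp
    · rw [max_eq_left (div_nonpos_of_nonpos_of_nonneg h0 hx.le), mul_zero,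
        ENNReal.ofReal_of_nonpos (mul_nonpos_of_nonneg_of_nonpos (by positivity) h0),
        ENNReal.ofReal_zero]
  · have h1 : ∀ w, (truncatedCone B).indicator coneDensity (x, y, w) = 0 := by
      intro w
      by_cases hc : (x, y, w) ∈ truncatedCone B
      · rw [Set.indicator_of_mem hc, coneDensity, if_neg]
        rintro ⟨-, h2, -⟩
        exact h ⟨h2.1, h2.2, hc.2.2⟩
      · rw [Set.indicator_of_notMem hc]
    simp only [h1, lintegral_zero]
    by_cases hyB : (x, y) ∈ B
    · rw [Set.indicator_of_mem hyB, weight, if_neg, ENNReal.ofReal_zero]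
      exact fun h' => h ⟨h'.1, h'.2, hyB⟩
    · rw [Set.indicator_of_notMem hyB]

/-- A convex set has Lebesgue null frontier, and the image measure is absolutely continuous. This is
the use of `homog`: it makes the condition `x (1 + u + v) ≤ 1` linear. -/
theorem cubeMeasure_frontier {S : Set (ℝ × ℝ × ℝ)} (hS : Convex ℝ S) :
    cubeMeasure (frontier (homog ⁻¹' S)) = 0 := by
  refine measure_mono_null (continuous_homog.frontier_preimage_subset S) ?_
  rw [← Measure.map_apply continuous_homog.measurable isClosed_frontier.measurableSet,
    map_homog_cubeMeasure]
  have : (volume : Measure (ℝ × ℝ × ℝ)).IsAddHaarMeasure :=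
    Measure.prod.instIsAddHaarMeasure _ _
  exact withDensity_absolutelyContinuous _ _ (hS.addHaar_frontier volume)

/-- The pairs `(b, r)` with `0 < r < b` coprime and `b + r + r⁻¹ ≤ N`, the inverse being taken
modulo `b`. -/
def saturated (N : ℕ) : Finset (ℕ × ℕ) :=
  {p ∈ pairs N | 0 < p.2 ∧ p.1 + p.2 + modInv p.1 p.2 ≤ N}

/-- The point `(a, b) / N`. -/
noncomputable def scaled (N : ℕ) (p : ℕ × ℕ) : ℝ × ℝ := ((p.1 : ℝ) / N, (p.2 : ℝ) / N)

theorem homog_point_mem {N : ℕ} (hN : 0 < N) {p : ℕ × ℕ} (hp : p ∈ pairs N) (B : Set (ℝ × ℝ)) :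
    homog (point N p) ∈ truncatedCone B ↔
      (0 < p.2 ∧ p.1 + p.2 + modInv p.1 p.2 ≤ N) ∧ scaled N p ∈ B := by
  have hN' : (0 : ℝ) < N := by exact_mod_cast hN
  have hb : 0 < p.1 := by have := (mem_pairs.mp hp).2.1; omega
  have hb' : (0 : ℝ) < p.1 := by exact_mod_cast hb
  have h1 : homog (point N p) = ((p.1 : ℝ) / N, (p.2 : ℝ) / N, (modInv p.1 p.2 : ℝ) / N) := by
    simp only [homog, point, Prod.mk.injEq, true_and]
    constructor <;> field_simp
  rw [h1]
  simp only [truncatedCone, Set.mem_ofPred_eq, scaled, ← add_div, div_le_one hN',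
    div_pos_iff_of_pos_right hN', Nat.cast_pos, and_assoc]
  norm_cast

-- Equidistribution applied to the truncated cone over `B`; convexity of `B` makes the frontier
-- null.
open Classical in
theorem tendsto_card_saturated {B : Set (ℝ × ℝ)} (hB : MeasurableSet B) (hc : Convex ℝ B) :
    Tendsto (fun N => (({p ∈ saturated N | scaled N p ∈ B}.card : ℕ) : ℝ) / totientSum N) atTop
      (𝓝 (∫ p in B, weight p)) := by
  rw [← tendsto_add_atTop_iff_nat 1]
  have h := (ENNReal.tendsto_toReal (measure_ne_top cubeMeasure _)).comp
    (tendsto_empirical (cubeMeasure_frontier (convex_truncatedCone hc)))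
  rw [cubeMeasure_truncatedCone hB, ← integral_eq_lintegral_of_nonneg_ae
    (Eventually.of_forall weight_nonneg) measurable_weight.aestronglyMeasurable] at h
  refine h.congr fun N => ?_
  rw [Function.comp, empirical_apply _ _
    (continuous_homog.measurable (measurableSet_truncatedCone hB)), saturated,
    Finset.filter_filter]
  congr 2
  refine congrArg _ (Finset.filter_congr fun p hp => ?_)
  exact homog_point_mem N.succ_pos hp B

theorem integrable_weight : Integrable weight := by
  refine ⟨measurable_weight.aestronglyMeasurable, ?_⟩
  rw [hasFiniteIntegral_iff_ofReal (Eventually.of_forall weight_nonneg),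
    ← setLIntegral_univ, ← cubeMeasure_truncatedCone MeasurableSet.univ]
  exact measure_lt_top _ _

end LimitFormula

/-! ### Consecutive saturated fractions -/

section Combinatorics

/-- The fraction `d / b` has a left neighbour whose denominator `a` satisfies `a + b + d ≤ Q`. -/
def IsSat (Q b d : ℕ) : Prop := ∃ a c : ℕ, a * d = b * c + 1 ∧ a + b + d ≤ Q

theorem IsSat.coprime {Q b d : ℕ} (h : IsSat Q b d) : d.Coprime b := by
  obtain ⟨a, c, h, -⟩ := h
  have h1 : d.gcd b ∣ b * c + 1 := h ▸ (Nat.gcd_dvd_left d b).mul_left a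
  exact Nat.dvd_one.mp ((Nat.dvd_add_right ((Nat.gcd_dvd_right d b).mul_right c)).mp h1)

/-- Subtract the second column of the matrix from the first. Conversely the remaining inequality `c
≤ a` comes for free from the determinant and `d ≤ b`. -/
theorem mem_fractions_iff {Q : ℕ} {x : ℚ} :
    x ∈ fractions Q ↔ ∃ b d : ℕ, 1 ≤ d ∧ d ≤ b ∧ IsSat Q b d ∧ x = (d : ℚ) / (b : ℚ) := by
  constructor
  · rintro ⟨a, b, c, d, h, hba, hdb, hd, hca, hdc, hQ, rfl⟩
    refine ⟨b, d, hd, hdb, ?_, rfl⟩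
    obtain ⟨a, rfl⟩ := Nat.exists_eq_add_of_le hba
    obtain ⟨c, rfl⟩ := Nat.exists_eq_add_of_le hdc
    refine ⟨a, c, ?_, by omega⟩
    zify
    push_cast at h
    linear_combination h
  · rintro ⟨b, d, hd, hdb, ⟨a, c, h, hQ⟩, rfl⟩
    refine ⟨b + a, b, d + c, d, ?_, by omega, hdb, hd, ?_, by omega, by omega, rfl⟩
    · zify at h
      push_cast
      linear_combination h
    · have : d * c < d * a := by nlinarith
      have := lt_of_mul_lt_mul_left this (Nat.zero_le d)
      omega

/-- Reducing `a` modulo `b` keeps the determinant and does not increase `a`, so any bound `a + b + d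
≤ Q` survives. -/
theorem exists_reduced {b d a c : ℕ} (hb : 2 ≤ b) (h : a * d = b * c + 1) :
    ∃ a' c', a' * d = b * c' + 1 ∧ 1 ≤ a' ∧ a' < b ∧ a' ≤ a ∧ c' < d := by
  have h1 := Nat.div_add_mod a b
  have h2 : a % b < b := Nat.mod_lt _ (by omega)
  have h4 : a % b * d + b * (a / b * d) = b * c + 1 := by
    rw [← h]; conv_rhs => rw [← h1]
    ring
  have h3 : 1 ≤ a % b * d := by
    rcases Nat.eq_zero_or_pos (a % b * d) with h0 | h0
    · exfalso
      rw [h0, zero_add] at h4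
      have : b ∣ 1 := (Nat.dvd_add_right (dvd_mul_right b c)).mp (h4 ▸ dvd_mul_right b _)
      have := Nat.le_of_dvd one_pos this
      omega
    · exact h0
  have h5 : a / b * d ≤ c := by
    refine le_of_mul_le_mul_left ?_ (show 0 < b by omega)
    omega
  obtain ⟨e, rfl⟩ := Nat.exists_eq_add_of_le h5
  have h6 : a % b * d = b * e + 1 := by
    have : b * (a / b * d + e) = b * (a / b * d) + b * e := mul_add _ _ _
    omega
  refine ⟨a % b, e, h6, Nat.pos_of_mul_pos_right h3, h2, Nat.mod_le _ _, ?_⟩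
  have : b * e < b * d := by nlinarith
  exact lt_of_mul_lt_mul_left this (Nat.zero_le b)

theorem inverse_unique {b d a c a' c' : ℕ} (h : a * d = b * c + 1) (h' : a' * d = b * c' + 1)
    (ha : a < b) (ha' : a' < b) : a = a' := by
  have hc : b.gcd d = 1 := by
    rw [Nat.gcd_comm]
    exact IsSat.coprime ⟨a, c, h, le_refl _⟩
  have h1 : a * d ≡ a' * d [MOD b] := by
    rw [h, h']
    refine Nat.ModEq.add_right 1 ?_
    exact (Nat.modEq_zero_iff_dvd.mpr (dvd_mul_right b c)).trans
      (Nat.modEq_zero_iff_dvd.mpr (dvd_mul_right b c')).symm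
  exact Nat.ModEq.eq_of_lt_of_lt (Nat.ModEq.cancel_right_of_coprime hc h1) ha ha'

/-- When `a ≥ 2`, the reduced inverse of `c` modulo `a` is below `a`, and `a < b`, `c < d`, so the
sum to be bounded is termwise smaller than `a + b + d`. -/
theorem isSat_leftParent {Q a b c d : ℕ} (h : a * d = b * c + 1) (hab : a < b) (hdb : d ≤ b)
    (hc : 1 ≤ c) (hcd : c < d) (hQ : a + b + d ≤ Q) : IsSat Q a c ∧ c ≤ a := by
  have hca : c ≤ a := by
    by_contra hlt
    have : b * (a + 1) ≤ b * c := Nat.mul_le_mul_left b (by omega)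
    have : a * d ≤ a * b := Nat.mul_le_mul_left a hdb
    nlinarith
  refine ⟨?_, hca⟩
  rcases Nat.lt_or_ge a 2 with ha | ha
  · obtain rfl : a = 1 := by omega
    obtain rfl : c = 1 := by omega
    exact ⟨1, 0, rfl, by omega⟩
  · obtain ⟨k, l, hkl⟩ : ∃ k l : ℕ, k * c = a * l + 1 := by
      have h1 : 1 ≤ d * (a - 1) := Nat.mul_pos (by omega) (by omega)
      -- Modulo `a` the inverse of `c` is `-b`, represented here by `b * (a - 1)`.
      refine ⟨b * (a - 1), d * (a - 1) - 1, ?_⟩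
      zify [h1, show 1 ≤ a by omega]
      zify at h
      linear_combination (-(a : ℤ) + 1) * h
    obtain ⟨a', c', h1, h2, h3, h4, h5⟩ := exists_reduced ha hkl
    exact ⟨a', c', h1, by omega⟩

/-- The left parent `c / a` is also a left neighbour of the right parent, and the sum for it is only
`b + (d - c)`. -/
theorem isSat_rightParent {Q a b c d : ℕ} (h : a * d = b * c + 1) (hab : a < b) (hdb : d ≤ b)
    (hcd : c < d) (hQ : a + b + d ≤ Q) :
    IsSat Q (b - a) (d - c) ∧ 1 ≤ d - c ∧ d - c ≤ b - a ∧ (d - c) * b = d * (b - a) + 1 := by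
  obtain ⟨e, rfl⟩ := Nat.exists_eq_add_of_lt hcd
  obtain ⟨f, rfl⟩ := Nat.exists_eq_add_of_lt hab
  have e1 : c + e + 1 - c = e + 1 := by omega
  have e2 : a + f + 1 - a = f + 1 := by omega
  rw [e1, e2]
  refine ⟨⟨a, c, by nlinarith, by omega⟩, by omega, ?_, by nlinarith⟩
  by_contra hlt
  have : (f + 2) * (a + f + 1) ≤ (e + 1) * (a + f + 1) := Nat.mul_le_mul_right _ (by omega)
  have : (c + e + 1) * (f + 1) ≤ (a + f + 1) * (f + 1) := Nat.mul_le_mul_right _ hdb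
  have ha : 1 ≤ a := by
    rcases Nat.eq_zero_or_pos a with rfl | h0
    · omega
    · exact h0
  nlinarith

/-- Consecutive saturated fractions `a₁ / q₁ < a₂ / q₂` are unimodular. -/
theorem unimodular_of_consecutive {Q q₁ a₁ q₂ a₂ : ℕ} (h₁ : IsSat Q q₁ a₁) (h₂ : IsSat Q q₂ a₂)
    (ha₁ : 1 ≤ a₁) (haq₁ : a₁ ≤ q₁) (ha₂ : 1 ≤ a₂) (haq₂ : a₂ ≤ q₂) (hlt : a₁ * q₂ < a₂ * q₁)
    (hcons : ∀ b d, 1 ≤ d → d ≤ b → IsSat Q b d → ¬ (a₁ * b < d * q₁ ∧ d * q₂ < a₂ * b)) :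
    a₂ * q₁ = a₁ * q₂ + 1 := by
  have hdvd : ∀ k : ℕ, ∀ m n : ℕ, m.Coprime n → k ∣ m → k ∣ n → k = 1 :=
    fun k m n h hm hn => Nat.dvd_one.mp (h ▸ Nat.dvd_gcd hm hn)
  obtain ⟨D, hD⟩ := Nat.exists_eq_add_of_le hlt.le
  suffices D = 1 by omega
  zify at hD
  -- Take the parent, facing the other fraction, of the one with the larger denominator. It is
  -- saturated, so it is not strictly between the two. If it equals the other fraction, then `D`
  -- divides a coprime pair and is `1`. If it lies beyond, the other fraction sits strictly inside a
  -- unimodular pair, and its denominator would be too large.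
  rcases Nat.lt_or_ge q₁ q₂ with hq | hq
  · obtain ⟨a, c, h, hQ⟩ := h₂
    have hcop := IsSat.coprime h₁
    obtain ⟨a, c, h, ha1, ha, haa, hc⟩ := exists_reduced (by omega) h
    have hc1 : 1 ≤ c := by
      rcases Nat.eq_zero_or_pos c with rfl | h0
      · exfalso
        have : a₂ = 1 := Nat.eq_one_of_mul_eq_one_left (by simpa using h)
        subst this
        nlinarith
      · exact h0
    obtain ⟨hs, hca⟩ := isSat_leftParent h ha haq₂ hc1 hc (by omega : a + q₂ + a₂ ≤ Q)
    have hn := hcons a c hc1 hca hs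
    have h1 : c * q₂ < a₂ * a := by nlinarith
    have h2 : c * q₁ ≤ a₁ * a := by
      by_contra h3
      exact hn ⟨by omega, h1⟩
    zify at h
    rcases h2.eq_or_lt with h3 | h3
    · zify at h3
      refine hdvd D a₁ q₁ hcop ⟨c, ?_⟩ ⟨a, ?_⟩
      · zify
        linear_combination (-(a₁ : ℤ)) * h - a₂ * h3 + c * hD
      · zify
        linear_combination (-(q₁ : ℤ)) * h + a * hD - q₂ * h3
    · exfalso
      zify at h3 hq hlt ha1
      have hDpos : (1 : ℤ) ≤ D := by linarith
      have e : (q₁ : ℤ) = a * D + q₂ * (a₁ * a - c * q₁) := by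
        linear_combination (-(q₁ : ℤ)) * h + a * hD
      nlinarith
  · have hq1 : 2 ≤ q₁ := by
      by_contra h0
      have e1 : q₁ = 1 := by omega
      have e2 : q₂ = 1 := by omega
      have e3 : a₂ = 1 := by omega
      subst e1 e2 e3
      omega
    obtain ⟨a, c, h, hQ⟩ := h₁
    have hcop := IsSat.coprime h₂
    obtain ⟨a, c, h, ha1, ha, haa, hc⟩ := exists_reduced hq1 h
    obtain ⟨hs, hd1, hd2, hd3⟩ := isSat_rightParent h ha haq₁ hc (by omega : a + q₁ + a₁ ≤ Q)
    have hn := hcons _ _ hd1 hd2 hs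
    have hb1 : 1 ≤ q₁ - a := by omega
    generalize a₁ - c = d at *
    generalize q₁ - a = b at *
    have h2 : a₂ * b ≤ d * q₂ := by
      by_contra h3
      exact hn ⟨by omega, by omega⟩
    zify at hd3
    rcases h2.eq_or_lt with h3 | h3
    · zify at h3
      refine hdvd D a₂ q₂ hcop ⟨d, ?_⟩ ⟨b, ?_⟩
      · zify
        linear_combination (-(a₂ : ℤ)) * hd3 + d * hD - a₁ * h3
      · zify
        linear_combination (-(q₂ : ℤ)) * hd3 + b * hD - q₁ * h3
    · exfalso
      zify at h3 hq hlt hb1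
      have hDpos : (1 : ℤ) ≤ D := by linarith
      have e : (q₂ : ℤ) = b * D + q₁ * (d * q₂ - a₂ * b) := by
        linear_combination (-(q₂ : ℤ)) * hd3 + b * hD
      nlinarith

/-- A saturated fraction strictly between the terms of a unimodular pair forces the mediant to be
saturated. -/
theorem isSat_mediant_of_between {Q q₁ a₁ q₂ a₂ b d : ℕ} (hq₁ : 1 ≤ q₁) (hq₂ : 1 ≤ q₂)
    (hu : a₂ * q₁ = a₁ * q₂ + 1) (hs : IsSat Q b d) (h1 : a₁ * b < d * q₁)
    (h2 : d * q₂ < a₂ * b) : IsSat Q (q₁ + q₂) (a₁ + a₂) := by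
  obtain ⟨a, c, h, hQ⟩ := hs
  refine ⟨q₁, a₁, by linarith, le_trans ?_ hQ⟩
  zify at *
  -- Coordinates of `d / b` and of its left neighbour `c / a` in the basis given by the unimodular
  -- pair. Lying strictly between means `i, j ≥ 1`, so `b ≥ q₁ + q₂` and `d ≥ a₁ + a₂`; what remains
  -- is `a ≥ q₁`.
  obtain ⟨i, hi⟩ : ∃ i : ℤ, i = a₂ * b - d * q₂ := ⟨_, rfl⟩
  obtain ⟨j, hj⟩ : ∃ j : ℤ, j = d * q₁ - a₁ * b := ⟨_, rfl⟩
  obtain ⟨i', hi'⟩ : ∃ i' : ℤ, i' = a₂ * a - c * q₂ := ⟨_, rfl⟩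
  obtain ⟨j', hj'⟩ : ∃ j' : ℤ, j' = c * q₁ - a₁ * a := ⟨_, rfl⟩
  have hi1 : 1 ≤ i := by linarith
  have hj1 : 1 ≤ j := by linarith
  have eb : (b : ℤ) = i * q₁ + j * q₂ := by rw [hi, hj]; linear_combination (-(b : ℤ)) * hu
  have ed : (d : ℤ) = i * a₁ + j * a₂ := by rw [hi, hj]; linear_combination (-(d : ℤ)) * hu
  have ea : (a : ℤ) = i' * q₁ + j' * q₂ := by rw [hi', hj']; linear_combination (-(a : ℤ)) * hu
  have edet : i' * j - j' * i = 1 := by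
    rw [hi, hj, hi', hj']
    linear_combination h + (a * d - b * c : ℤ) * hu
  have ha0 : (0 : ℤ) ≤ a := Nat.cast_nonneg a
  have ha₁ : (0 : ℤ) ≤ a₁ := Nat.cast_nonneg a₁
  have ha₂ : (0 : ℤ) ≤ a₂ := Nat.cast_nonneg a₂
  have hq₁0 : (0 : ℤ) ≤ q₁ := by linarith
  have hq₂0 : (0 : ℤ) ≤ q₂ := by linarith
  have hj0 : 0 ≤ j := by linarith
  have hpos : 0 < i' * j → 0 < i' := fun h => pos_of_mul_pos_left h hj0
  have haq : (q₁ : ℤ) ≤ a := by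
    -- A negative `j'` would force `i' ≤ 0` by the determinant, hence `a < 0`; otherwise `i' ≥ 1`.
    rcases lt_trichotomy j' 0 with hneg | hz | hp
    · exfalso
      have e1 : j' * i ≤ j' * 1 := mul_le_mul_of_nonpos_left hi1 hneg.le
      have e2 : i' ≤ 0 := by
        by_contra hc
        have := mul_pos (not_le.mp hc) (show 0 < j by linarith)
        linarith
      have e3 := mul_nonpos_of_nonpos_of_nonneg e2 hq₁0
      have e4 := mul_neg_of_neg_of_pos hneg (show (0 : ℤ) < q₂ by linarith)
      linarith
    · rw [hz, zero_mul, sub_zero] at edet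
      have e1 := le_mul_of_one_le_left hq₁0 (hpos (by linarith) : 1 ≤ i')
      rw [ea, hz, zero_mul, add_zero]
      exact e1
    · have e0 := mul_pos hp (show 0 < i by linarith)
      have e1 := le_mul_of_one_le_left hq₁0 (hpos (by linarith) : 1 ≤ i')
      have e2 := mul_nonneg hp.le hq₂0
      linarith
  have e1 := le_mul_of_one_le_left hq₁0 hi1
  have e2 := le_mul_of_one_le_left hq₂0 hj1
  have e3 := le_mul_of_one_le_left ha₁ hi1
  have e4 := le_mul_of_one_le_left ha₂ hj1
  linarith

theorem den_natCast_div {a b : ℕ} (hb : 0 < b) (h : a.Coprime b) : ((a : ℚ) / (b : ℚ)).den = b := by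
  have := Rat.den_div_eq_of_coprime (a := (a : ℤ)) (b := (b : ℤ)) (by exact_mod_cast hb)
    (by simpa using h)
  simp only [Int.cast_natCast] at this
  exact Int.natCast_inj.mp this

/-- Any saturated fraction strictly between a unimodular pair forces the mediant to be saturated, so
the mediant alone has to be tested. -/
theorem mem_denominators_iff {Q q₁ q₂ : ℕ} :
    (q₁, q₂) ∈ denominators Q ↔ ∃ a₁ a₂, 1 ≤ a₁ ∧ a₁ ≤ q₁ ∧ 1 ≤ a₂ ∧ a₂ ≤ q₂ ∧
      a₂ * q₁ = a₁ * q₂ + 1 ∧ IsSat Q q₁ a₁ ∧ IsSat Q q₂ a₂ ∧ ¬ IsSat Q (q₁ + q₂) (a₁ + a₂) := by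
  have hlt : ∀ {a b c d : ℕ}, 0 < b → 0 < d → ((a : ℚ) / b < (c : ℚ) / d ↔ a * d < c * b) := by
    intro a b c d hb hd
    rw [div_lt_div_iff₀ (by exact_mod_cast hb) (by exact_mod_cast hd)]
    exact_mod_cast Iff.rfl
  constructor
  · rintro ⟨x, hx, y, hy, hxy, hc, hp⟩
    obtain ⟨b₁, a₁, ha₁, hab₁, hs₁, rfl⟩ := mem_fractions_iff.mp hx
    obtain ⟨b₂, a₂, ha₂, hab₂, hs₂, rfl⟩ := mem_fractions_iff.mp hy
    rw [den_natCast_div (by omega) hs₁.coprime, den_natCast_div (by omega) hs₂.coprime,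
      Prod.mk.injEq] at hp
    obtain ⟨rfl, rfl⟩ := hp
    have hxy' := (hlt (by omega) (by omega)).mp hxy
    have hcons : ∀ b d, 1 ≤ d → d ≤ b → IsSat Q b d →
        ¬ (a₁ * b < d * q₁ ∧ d * q₂ < a₂ * b) := by
      intro b d hd hdb hs h
      refine hc _ (mem_fractions_iff.mpr ⟨b, d, hd, hdb, hs, rfl⟩) ⟨?_, ?_⟩
      · exact (hlt (by omega) (by omega)).mpr h.1
      · exact (hlt (by omega) (by omega)).mpr h.2
    have hu := unimodular_of_consecutive hs₁ hs₂ ha₁ hab₁ ha₂ hab₂ hxy' hcons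
    refine ⟨a₁, a₂, ha₁, hab₁, ha₂, hab₂, hu, hs₁, hs₂, fun hs => ?_⟩
    refine hcons _ _ (by omega) (by omega) hs ⟨?_, ?_⟩ <;> nlinarith
  · rintro ⟨a₁, a₂, ha₁, hab₁, ha₂, hab₂, hu, hs₁, hs₂, hn⟩
    refine ⟨_, mem_fractions_iff.mpr ⟨q₁, a₁, ha₁, hab₁, hs₁, rfl⟩,
      _, mem_fractions_iff.mpr ⟨q₂, a₂, ha₂, hab₂, hs₂, rfl⟩, ?_, ?_, ?_⟩
    · rw [hlt (by omega) (by omega)]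
      omega
    · rintro z hz ⟨h1, h2⟩
      obtain ⟨b, d, hd, hdb, hs, rfl⟩ := mem_fractions_iff.mp hz
      rw [hlt (by omega) (by omega)] at h1 h2
      exact hn (isSat_mediant_of_between (by omega) (by omega) hu hs h1 h2)
    · rw [den_natCast_div (by omega) hs₁.coprime, den_natCast_div (by omega) hs₂.coprime]

theorem modInv_spec {b r : ℕ} (hb : 2 ≤ b) (h : b.Coprime r) :
    ∃ c, modInv b r * r = b * c + 1 := by
  have : NeZero b := ⟨by omega⟩
  have h1 : ((modInv b r * r : ℕ) : ZMod b) = ((1 : ℕ) : ZMod b) := by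
    rw [Nat.cast_mul, modInv, ZMod.natCast_zmod_val, mul_comm,
      ZMod.coe_mul_inv_eq_one r h.symm, Nat.cast_one]
  rw [ZMod.natCast_eq_natCast_iff', Nat.mod_eq_of_lt (show 1 < b by omega)] at h1
  exact ⟨modInv b r * r / b, by rw [← h1, Nat.div_add_mod]⟩

theorem mem_saturated_iff {Q b r : ℕ} :
    (b, r) ∈ saturated Q ↔ 0 < r ∧ r < b ∧ ∃ t c, t < b ∧ t * r = b * c + 1 ∧ b + r + t ≤ Q := by
  simp only [saturated, Finset.mem_filter, mem_pairs]
  constructor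
  · rintro ⟨⟨h1, h2, h3⟩, h4, h5⟩
    obtain ⟨c, hc⟩ := modInv_spec (by omega) h3
    exact ⟨h4, h2, _, c, modInv_lt (by omega) r, hc, h5⟩
  · rintro ⟨h1, h2, t, c, ht, h, hQ⟩
    have hcop : b.Coprime r := (IsSat.coprime ⟨t, c, h, le_rfl⟩).symm
    obtain ⟨c', hc'⟩ := modInv_spec (by omega) hcop
    have := inverse_unique h hc' ht (modInv_lt (by omega) r)
    exact ⟨⟨by omega, h2, hcop⟩, h1, by omega⟩

/-- The mediant of a unimodular pair is saturated iff the corresponding pair of denominators is. -/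
theorem isSat_mediant_iff {Q q₁ q₂ a₁ a₂ : ℕ} (hu : a₂ * q₁ = a₁ * q₂ + 1) (hq₁ : 0 < q₁)
    (hq₂ : 0 < q₂) (h₁ : a₁ < q₁ ∨ a₂ < q₂) (ha₁ : a₁ ≤ q₁) (ha₂ : a₂ ≤ q₂) :
    IsSat Q (q₁ + q₂) (a₁ + a₂) ↔ (q₁ + q₂, q₁) ∈ saturated Q := by
  have hdet : q₁ * (a₁ + a₂) = (q₁ + q₂) * a₁ + 1 := by linarith
  rw [mem_saturated_iff]
  constructor
  · rintro ⟨a, c, h, hQ⟩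
    obtain ⟨a, c, h, -, ha, haa, -⟩ := exists_reduced (by omega) h
    have := inverse_unique h hdet ha (by omega)
    exact ⟨hq₁, by omega, a₁ + a₂, a₁, by omega, by linarith, by omega⟩
  · rintro ⟨-, -, t, c, ht, h, hQ⟩
    have := inverse_unique h (by linarith : (a₁ + a₂) * q₁ = (q₁ + q₂) * a₁ + 1) ht (by omega)
    exact ⟨q₁, a₁, hdet, by omega⟩

/-- Modulo `q₁` the inverse of `a₁` is `-q₂`, that is `q₁ - q₂`. The fraction with denominator `q₂`
is the right parent, so its saturation is automatic. -/
theorem mem_denominators_iff_of_gt {Q q₁ q₂ : ℕ} (hq : q₂ < q₁) :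
    (q₁, q₂) ∈ denominators Q ↔
      (q₁, q₁ - q₂) ∈ saturated Q ∧ (q₁ + q₂, q₁) ∉ saturated Q := by
  rw [mem_denominators_iff]
  constructor
  · rintro ⟨a₁, a₂, ha₁, hab₁, ha₂, hab₂, hu, hs₁, hs₂, hn⟩
    have hlt : a₁ < q₁ := by
      refine lt_of_le_of_ne hab₁ fun h => ?_
      have := hs₁.coprime
      rw [h, Nat.coprime_self] at this
      omega
    rw [isSat_mediant_iff hu (by omega) (by omega) (Or.inl hlt) hab₁ hab₂] at hn
    refine ⟨?_, hn⟩
    rw [mem_saturated_iff]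
    obtain ⟨a, c, h, hQ⟩ := hs₁
    obtain ⟨a, c, h, -, ha, haa, -⟩ := exists_reduced (by omega) h
    have h21 : a₂ ≤ a₁ := by
      by_contra hlt
      have : (a₁ + 1) * q₁ ≤ a₂ * q₁ := Nat.mul_le_mul_right _ (by omega)
      have : a₁ * (q₂ + 1) ≤ a₁ * q₁ := Nat.mul_le_mul_left _ hq
      nlinarith
    have hdet : (q₁ - q₂) * a₁ = q₁ * (a₁ - a₂) + 1 := by
      zify [hq.le, h21]
      zify at hu
      linear_combination hu
    have := inverse_unique h hdet ha (by omega)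
    exact ⟨by omega, by omega, a₁, a₁ - a₂, hlt, by linarith, by omega⟩
  · rintro ⟨hs, hn⟩
    obtain ⟨h0, h1, t, c, ht, h, hQ⟩ := mem_saturated_iff.mp hs
    have h' : (q₁ - q₂) * t = q₁ * c + 1 := by linarith
    have hct : c < t := by
      have : q₁ * c < q₁ * t := by nlinarith
      exact lt_of_mul_lt_mul_left this (Nat.zero_le _)
    obtain ⟨hs2, hr1, hr2, hr3⟩ := isSat_rightParent h' h1 ht.le hct (by omega : _ ≤ Q)
    have e : q₁ - (q₁ - q₂) = q₂ := by omega
    rw [e] at hs2 hr2 hr3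
    refine ⟨t, t - c, ?_, ht.le, hr1, hr2, hr3, ⟨q₁ - q₂, c, h', by omega⟩, hs2, ?_⟩
    · omega
    · rwa [isSat_mediant_iff hr3 (by omega) (by omega) (Or.inl ht) ht.le hr2]

theorem two_le_of_mem_denominators {Q q₁ q₂ : ℕ} (h : (q₁, q₂) ∈ denominators Q) : 2 ≤ q₁ := by
  obtain ⟨a₁, a₂, ha₁, hab₁, ha₂, hab₂, hu, -⟩ := mem_denominators_iff.mp h
  by_contra hlt
  obtain rfl : q₁ = 1 := by omega
  obtain rfl : a₁ = 1 := by omega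
  omega

/-- Modulo `q₂` the inverse of `a₂` is `q₁`, and the other fraction is the left parent. For `q₁ = 1`
that parent would be `0 / 1`, which is not among the fractions. -/
theorem mem_denominators_iff_of_lt {Q q₁ q₂ : ℕ} (hq : q₁ < q₂) :
    (q₁, q₂) ∈ denominators Q ↔
      2 ≤ q₁ ∧ (q₂, q₁) ∈ saturated Q ∧ (q₁ + q₂, q₁) ∉ saturated Q := by
  constructor
  · intro hD
    refine ⟨two_le_of_mem_denominators hD, ?_⟩
    obtain ⟨a₁, a₂, ha₁, hab₁, ha₂, hab₂, hu, hs₁, hs₂, hn⟩ := mem_denominators_iff.mp hD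
    have hlt : a₂ < q₂ := by
      refine lt_of_le_of_ne hab₂ fun h => ?_
      have := hs₂.coprime
      rw [h, Nat.coprime_self] at this
      omega
    rw [isSat_mediant_iff hu (by omega) (by omega) (Or.inr hlt) hab₁ hab₂] at hn
    refine ⟨?_, hn⟩
    rw [mem_saturated_iff]
    obtain ⟨a, c, h, hQ⟩ := hs₂
    obtain ⟨a, c, h, -, ha, haa, -⟩ := exists_reduced (by omega) h
    have := inverse_unique h (by linarith : q₁ * a₂ = q₂ * a₁ + 1) ha hq
    exact ⟨by omega, hq, a₂, a₁, hlt, by linarith, by omega⟩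
  · rintro ⟨h2, hs, hn⟩
    rw [mem_denominators_iff]
    obtain ⟨h0, h1, t, c, ht, h, hQ⟩ := mem_saturated_iff.mp hs
    have h' : q₁ * t = q₂ * c + 1 := by linarith
    have hct : c < t := by
      have : q₂ * c < q₂ * t := by nlinarith
      exact lt_of_mul_lt_mul_left this (Nat.zero_le _)
    have hc1 : 1 ≤ c := by
      rcases Nat.eq_zero_or_pos c with rfl | h0
      · exfalso
        have : q₁ = 1 := Nat.eq_one_of_mul_eq_one_right (by simpa using h')
        omega
      · exact h0
    obtain ⟨hs1, hcq⟩ := isSat_leftParent h' hq ht.le hc1 hct (by omega : _ ≤ Q)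
    have hu : t * q₁ = c * q₂ + 1 := by linarith
    refine ⟨c, t, hc1, hcq, by omega, ht.le, hu, hs1, ⟨q₁, c, h', by omega⟩, ?_⟩
    rwa [isSat_mediant_iff hu (by omega) (by omega) (Or.inr ht) hcq ht.le]

/-- Makes the pairs to be removed a subset of the candidates, so that cardinalities subtract. With
`c` and `e = t - c` as numerators of the two parents, the larger denominator is an old parent with a
smaller sum. -/
theorem saturated_of_mediant {Q q₁ q₂ : ℕ} (h : (q₁ + q₂, q₁) ∈ saturated Q) :
    (q₂ < q₁ → (q₁, q₁ - q₂) ∈ saturated Q) ∧ (q₁ < q₂ → (q₂, q₁) ∈ saturated Q) := by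
  obtain ⟨h0, h1, t, c, ht, h, hQ⟩ := mem_saturated_iff.mp h
  have hct : c < t := by
    have : (q₁ + q₂) * c < (q₁ + q₂) * t := by nlinarith
    exact lt_of_mul_lt_mul_left this (Nat.zero_le _)
  have hcq : c < q₁ := by
    have : (q₁ + q₂) * c < (q₁ + q₂) * q₁ := by nlinarith
    exact lt_of_mul_lt_mul_left this (Nat.zero_le _)
  obtain ⟨e, rfl⟩ := Nat.exists_eq_add_of_le hct.le
  have hu : e * q₁ = q₂ * c + 1 := by linarith
  constructor
  · intro hq
    have hc0 : 0 < c := by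
      rcases Nat.eq_zero_or_pos c with rfl | hc
      · exfalso
        have : q₁ = 1 := Nat.eq_one_of_mul_eq_one_left (by simpa using hu)
        omega
      · exact hc
    have hec : e ≤ c := by
      by_contra hlt
      have : (c + 1) * q₁ ≤ e * q₁ := Nat.mul_le_mul_right _ (by omega)
      have : c * (q₂ + 1) ≤ c * q₁ := Nat.mul_le_mul_left _ hq
      nlinarith
    refine mem_saturated_iff.mpr ⟨by omega, by omega, c, c - e, hcq, ?_, by omega⟩
    zify [hq.le, hec]
    zify at hu
    linear_combination hu
  · intro hq
    refine mem_saturated_iff.mpr ⟨h0, hq, e, c, ?_, hu, by omega⟩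
    by_contra hlt
    have : q₂ * q₁ ≤ e * q₁ := Nat.mul_le_mul_right _ (by omega)
    have : q₂ * (c + 1) ≤ q₂ * q₁ := Nat.mul_le_mul_left _ hcq
    nlinarith

end Combinatorics

/-! ### Counting denominators as differences of saturated pairs -/

section Counting

open Finset Classical

theorem mem_denominatorsIn {N : ℕ} (hN : 0 < N) {R : Set (ℝ × ℝ)} {p : ℕ × ℕ} :
    p ∈ denominatorsIn N R ↔ p ∈ denominators N ∧ scaled N p ∈ R := by
  have hN' : (N : ℝ) ≠ 0 := by exact_mod_cast hN.ne'
  simp only [denominatorsIn, Set.mem_ofPred_eq, scaled]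
  refine and_congr_right fun _ => ⟨?_, fun h => ⟨_, h, ?_, ?_⟩⟩
  · rintro ⟨r, hr, h1, h2⟩
    rw [h1, h2, mul_div_cancel_left₀ _ hN', mul_div_cancel_left₀ _ hN']
    exact hr
  · field_simp
  · field_simp

theorem lt_of_mem_saturated {N : ℕ} {p : ℕ × ℕ} (h : p ∈ saturated N) :
    0 < p.2 ∧ p.2 < p.1 ∧ p.1 ≤ N := by
  obtain ⟨h1, h2, t, c, ht, h3, hQ⟩ := mem_saturated_iff.mp (show (p.1, p.2) ∈ _ from h)
  exact ⟨h1, h2, by omega⟩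

/-- The involution `(b, r) ↦ (b, b - r)`. -/
def reflect (p : ℝ × ℝ) : ℝ × ℝ := (p.1, p.1 - p.2)

/-- The denominators of the parents `(r, b - r)` of a fraction with denominator `b`. -/
def parents (p : ℝ × ℝ) : ℝ × ℝ := (p.2, p.1 - p.2)

theorem scaled_reflect {N : ℕ} {p : ℕ × ℕ} (h : p.2 ≤ p.1) :
    scaled N (p.1, p.1 - p.2) = reflect (scaled N p) := by
  simp [scaled, reflect, Nat.cast_sub h, sub_div]

theorem scaled_parents {N : ℕ} {p : ℕ × ℕ} (h : p.2 ≤ p.1) :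
    scaled N (p.2, p.1 - p.2) = parents (scaled N p) := by
  simp [scaled, parents, Nat.cast_sub h, sub_div]

theorem mem_image_reflect {N : ℕ} {R : Set (ℝ × ℝ)} {q₁ q₂ : ℕ} :
    (q₁, q₂) ∈ ({p ∈ saturated N | scaled N p ∈ reflect ⁻¹' R} : Finset (ℕ × ℕ)).image
      (fun p => (p.1, p.1 - p.2)) ↔
      scaled N (q₁, q₂) ∈ R ∧ q₂ < q₁ ∧ (q₁, q₁ - q₂) ∈ saturated N := by
  simp only [mem_image, mem_filter, Set.mem_preimage]
  constructor
  · rintro ⟨⟨b, r⟩, ⟨h1, h2⟩, h3⟩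
    obtain ⟨h4, h5, h6⟩ := lt_of_mem_saturated h1
    rw [← scaled_reflect h5.le, h3] at h2
    simp only [Prod.mk.injEq] at h3 h4 h5
    obtain ⟨rfl, rfl⟩ := h3
    exact ⟨h2, by omega, by rwa [Nat.sub_sub_self h5.le]⟩
  · rintro ⟨h1, h2, h3⟩
    have e : (q₁, q₁ - (q₁ - q₂)) = (q₁, q₂) := by rw [Nat.sub_sub_self h2.le]
    refine ⟨(q₁, q₁ - q₂), ⟨h3, ?_⟩, e⟩
    rw [← scaled_reflect (by simp), e]
    exact h1

theorem mem_image_parents {N : ℕ} {R : Set (ℝ × ℝ)} {q₁ q₂ : ℕ} :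
    (q₁, q₂) ∈ ({p ∈ saturated N | scaled N p ∈ parents ⁻¹' R} : Finset (ℕ × ℕ)).image
      (fun p => (p.2, p.1 - p.2)) ↔
      scaled N (q₁, q₂) ∈ R ∧ (q₁ + q₂, q₁) ∈ saturated N := by
  simp only [mem_image, mem_filter, Set.mem_preimage]
  constructor
  · rintro ⟨⟨b, r⟩, ⟨h1, h2⟩, h3⟩
    obtain ⟨h4, h5, h6⟩ := lt_of_mem_saturated h1
    rw [← scaled_parents h5.le, h3] at h2
    simp only [Prod.mk.injEq] at h3 h4 h5
    obtain ⟨rfl, rfl⟩ := h3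
    exact ⟨h2, by rwa [Nat.add_sub_cancel' h5.le]⟩
  · rintro ⟨h1, h2⟩
    have e : (q₁, q₁ + q₂ - q₁) = (q₁, q₂) := by rw [Nat.add_sub_cancel_left]
    refine ⟨(q₁ + q₂, q₁), ⟨h2, ?_⟩, e⟩
    rw [← scaled_parents (by simp), e]
    exact h1

theorem mem_image_swap {N : ℕ} {R : Set (ℝ × ℝ)} {q₁ q₂ : ℕ} :
    (q₁, q₂) ∈ ({p ∈ saturated N | scaled N p ∈ Prod.swap ⁻¹' R} : Finset (ℕ × ℕ)).image
      Prod.swap ↔ scaled N (q₁, q₂) ∈ R ∧ (q₂, q₁) ∈ saturated N := by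
  simp only [mem_image, mem_filter, Set.mem_preimage]
  constructor
  · rintro ⟨⟨b, r⟩, ⟨h1, h2⟩, h3⟩
    simp only [Prod.swap_prod_mk, Prod.mk.injEq] at h3
    obtain ⟨rfl, rfl⟩ := h3
    exact ⟨h2, h1⟩
  · rintro ⟨h1, h2⟩
    exact ⟨(q₂, q₁), ⟨h2, h1⟩, rfl⟩

theorem card_image_reflect (N : ℕ) (P : ℕ × ℕ → Prop) :
    #({p ∈ saturated N | P p}.image fun p => (p.1, p.1 - p.2)) = #{p ∈ saturated N | P p} := by
  refine card_image_of_injOn ?_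
  rintro ⟨b, r⟩ h ⟨b', r'⟩ h' he
  have h1 := lt_of_mem_saturated (mem_filter.mp h).1
  have h2 := lt_of_mem_saturated (mem_filter.mp h').1
  simp only [Prod.mk.injEq] at *
  omega

theorem card_image_parents (N : ℕ) (P : ℕ × ℕ → Prop) :
    #({p ∈ saturated N | P p}.image fun p => (p.2, p.1 - p.2)) = #{p ∈ saturated N | P p} := by
  refine card_image_of_injOn ?_
  rintro ⟨b, r⟩ h ⟨b', r'⟩ h' he
  have h1 := lt_of_mem_saturated (mem_filter.mp h).1
  have h2 := lt_of_mem_saturated (mem_filter.mp h').1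
  simp only [Prod.mk.injEq] at *
  omega

theorem lt_iff_scaled {N : ℕ} (hN : 0 < N) {q₁ q₂ : ℕ} :
    (scaled N (q₁, q₂)).1 < (scaled N (q₁, q₂)).2 ↔ q₁ < q₂ := by
  have hN' : (0 : ℝ) < N := by exact_mod_cast hN
  simp only [scaled]
  rw [div_lt_div_iff_of_pos_right hN', Nat.cast_lt]

theorem gt_iff_scaled {N : ℕ} (hN : 0 < N) {q₁ q₂ : ℕ} :
    (scaled N (q₁, q₂)).2 < (scaled N (q₁, q₂)).1 ↔ q₂ < q₁ := by
  have hN' : (0 : ℝ) < N := by exact_mod_cast hN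
  simp only [scaled]
  rw [div_lt_div_iff_of_pos_right hN', Nat.cast_lt]

theorem ncard_denominatorsIn_of_gt {N : ℕ} (hN : 0 < N) {R : Set (ℝ × ℝ)}
    (hR : ∀ p ∈ R, p.2 < p.1) :
    ((denominatorsIn N R).ncard : ℝ) =
      #{p ∈ saturated N | scaled N p ∈ reflect ⁻¹' R} -
        #{p ∈ saturated N | scaled N p ∈ parents ⁻¹' R} := by
  rw [← card_image_reflect, ← card_image_parents, ← Nat.cast_sub, ← card_sdiff_of_subset,
    ← Set.ncard_coe_finset]
  · congr 2
    ext ⟨q₁, q₂⟩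
    rw [mem_denominatorsIn hN, mem_coe, Finset.mem_sdiff, mem_image_reflect, mem_image_parents]
    constructor
    · rintro ⟨h1, h2⟩
      have hq := (gt_iff_scaled hN).mp (hR _ h2)
      obtain ⟨h3, h4⟩ := (mem_denominators_iff_of_gt hq).mp h1
      exact ⟨⟨h2, hq, h3⟩, fun h => h4 h.2⟩
    · rintro ⟨⟨h2, hq, h3⟩, h4⟩
      exact ⟨(mem_denominators_iff_of_gt hq).mpr ⟨h3, fun h => h4 ⟨h2, h⟩⟩, h2⟩
  -- Two side goals remain, an inclusion and the resulting inequality of cardinalities; both come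
  -- from `saturated_of_mediant`.
  all_goals
    first
    | refine card_le_card ?_
    | skip
    rintro ⟨q₁, q₂⟩ h
    rw [mem_image_parents] at h
    rw [mem_image_reflect]
    have hq := (gt_iff_scaled hN).mp (hR _ h.1)
    exact ⟨h.1, hq, (saturated_of_mediant h.2).1 hq⟩

/-- The error accounts for the pairs with `q₁ = 1`, of which there are at most `N + 1`. -/
theorem ncard_denominatorsIn_of_lt {N : ℕ} (hN : 0 < N) {R : Set (ℝ × ℝ)}
    (hR : ∀ p ∈ R, p.1 < p.2) :
    |((denominatorsIn N R).ncard : ℝ) - (#{p ∈ saturated N | scaled N p ∈ Prod.swap ⁻¹' R} -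
        #{p ∈ saturated N | scaled N p ∈ parents ⁻¹' R})| ≤ N + 1 := by
  rw [← card_image_of_injective _ Prod.swap_injective, ← card_image_parents]
  set A := ({p ∈ saturated N | scaled N p ∈ Prod.swap ⁻¹' R} : Finset (ℕ × ℕ)).image Prod.swap
    with hA
  set B := ({p ∈ saturated N | scaled N p ∈ parents ⁻¹' R} : Finset (ℕ × ℕ)).image
    (fun p => (p.2, p.1 - p.2)) with hB
  have hBA : B ⊆ A := by
    rintro ⟨q₁, q₂⟩ h
    rw [hB, mem_image_parents] at h
    rw [hA, mem_image_swap]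
    have hq := (lt_iff_scaled hN).mp (hR _ h.1)
    exact ⟨h.1, (saturated_of_mediant h.2).2 hq⟩
  have h1 : (denominatorsIn N R).ncard ≤ #(A \ B) := by
    rw [← Set.ncard_coe_finset]
    refine Set.ncard_le_ncard ?_ (finite_toSet _)
    rintro ⟨q₁, q₂⟩ h
    obtain ⟨h1, h2⟩ := (mem_denominatorsIn hN).mp h
    have hq := (lt_iff_scaled hN).mp (hR _ h2)
    obtain ⟨-, h3, h4⟩ := (mem_denominators_iff_of_lt hq).mp h1
    rw [mem_coe, Finset.mem_sdiff, hA, hB, mem_image_swap, mem_image_parents]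
    exact ⟨⟨h2, h3⟩, fun h => h4 h.2⟩
  have h2 : #(A \ B) ≤ (denominatorsIn N R).ncard + (N + 1) := by
    have hfin : (denominatorsIn N R).Finite := (denominators_finite N).subset fun p hp => hp.1
    have hc : (N + 1) = Set.ncard (((range (N + 1)).image fun q : ℕ => (1, q) : Finset (ℕ × ℕ)) :
        Set (ℕ × ℕ)) := by
      rw [Set.ncard_coe_finset, card_image_of_injective _ (fun a b h => (Prod.mk.inj h).2),
        card_range]
    rw [← Set.ncard_coe_finset]
    conv_rhs => rw [hc]
    refine (Set.ncard_le_ncard ?_ (hfin.union (finite_toSet _))).trans (Set.ncard_union_le _ _)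
    rintro ⟨q₁, q₂⟩ h
    rw [mem_coe, Finset.mem_sdiff, hA, hB, mem_image_swap, mem_image_parents] at h
    obtain ⟨⟨h2, h3⟩, h4⟩ := h
    have hq := (lt_iff_scaled hN).mp (hR _ h2)
    obtain ⟨h5, -, h6⟩ := lt_of_mem_saturated h3
    rcases Nat.lt_or_ge q₁ 2 with hq1 | hq1
    · right
      simp only at h5 h6
      rw [mem_coe, mem_image]
      exact ⟨q₂, by rw [mem_range]; omega, by rw [show q₁ = 1 by omega]⟩
    · left
      rw [mem_denominatorsIn hN]
      exact ⟨(mem_denominators_iff_of_lt hq).mpr ⟨hq1, h3, fun h => h4 ⟨h2, h⟩⟩, h2⟩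
  rw [card_sdiff_of_subset hBA] at h1 h2
  have h3 := card_le_card hBA
  have h1' : ((denominatorsIn N R).ncard : ℝ) ≤ ((#A - #B : ℕ) : ℝ) := by exact_mod_cast h1
  have h2' : ((#A - #B : ℕ) : ℝ) ≤ ((denominatorsIn N R).ncard : ℝ) + (N + 1) := by
    exact_mod_cast h2
  rw [Nat.cast_sub h3] at h1' h2'
  rw [abs_le]
  constructor <;> linarith

theorem isLinearMap_reflect : IsLinearMap ℝ reflect :=
  ⟨fun x y => by ext <;> simp [reflect]; ring, fun c x => by ext <;> simp [reflect]; ring⟩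

theorem isLinearMap_parents : IsLinearMap ℝ parents :=
  ⟨fun x y => by ext <;> simp [parents]; ring, fun c x => by ext <;> simp [parents]; ring⟩

theorem isLinearMap_swap : IsLinearMap ℝ (Prod.swap : ℝ × ℝ → ℝ × ℝ) :=
  ⟨fun x y => by ext <;> simp, fun c x => by ext <;> simp⟩

theorem continuous_reflect : Continuous reflect := by unfold reflect; fun_prop

theorem continuous_parents : Continuous parents := by unfold parents; fun_prop

theorem tendsto_ncard_of_gt {R : Set (ℝ × ℝ)} (hm : MeasurableSet R) (hc : Convex ℝ R)
    (hR : ∀ p ∈ R, p.2 < p.1) :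
    Tendsto (fun N => ((denominatorsIn N R).ncard : ℝ) / totientSum N) atTop
      (𝓝 ((∫ p in reflect ⁻¹' R, weight p) - ∫ p in parents ⁻¹' R, weight p)) := by
  have h1 := tendsto_card_saturated (continuous_reflect.measurable hm)
    (hc.is_linear_preimage isLinearMap_reflect)
  have h2 := tendsto_card_saturated (continuous_parents.measurable hm)
    (hc.is_linear_preimage isLinearMap_parents)
  refine (h1.sub h2).congr' ?_
  filter_upwards [eventually_gt_atTop 0] with N hN
  rw [ncard_denominatorsIn_of_gt hN hR, sub_div]

theorem tendsto_succ_div_totientSum :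
    Tendsto (fun N : ℕ => ((N : ℝ) + 1) / totientSum N) atTop (𝓝 0) := by
  have h1 : Tendsto (fun N : ℕ => (1 / (N : ℝ) + 1 / N * (1 / N)) / (totientSum N / (N : ℝ) ^ 2))
      atTop (𝓝 0) := by
    have h := tendsto_one_div_atTop_nhds_zero_nat (𝕜 := ℝ)
    have := (h.add (h.mul h)).div tendsto_totientSum_div_sq totientConst_pos.ne'
    rw [mul_zero, add_zero, zero_div] at this
    exact this
  refine h1.congr' ?_
  filter_upwards [eventually_gt_atTop 0] with N hN
  have hN' : (N : ℝ) ≠ 0 := by exact_mod_cast hN.ne'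
  have hN3 : (totientSum N : ℝ) ≠ 0 := by exact_mod_cast (totientSum_pos hN).ne'
  field_simp

theorem tendsto_ncard_of_lt {R : Set (ℝ × ℝ)} (hm : MeasurableSet R) (hc : Convex ℝ R)
    (hR : ∀ p ∈ R, p.1 < p.2) :
    Tendsto (fun N => ((denominatorsIn N R).ncard : ℝ) / totientSum N) atTop
      (𝓝 ((∫ p in Prod.swap ⁻¹' R, weight p) - ∫ p in parents ⁻¹' R, weight p)) := by
  have h1 := tendsto_card_saturated (measurable_swap hm)
    (hc.is_linear_preimage isLinearMap_swap)
  have h2 := tendsto_card_saturated (continuous_parents.measurable hm)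
    (hc.is_linear_preimage isLinearMap_parents)
  have h3 : Tendsto (fun N => ((denominatorsIn N R).ncard : ℝ) / totientSum N -
      ((#{p ∈ saturated N | scaled N p ∈ Prod.swap ⁻¹' R} : ℝ) / totientSum N -
        (#{p ∈ saturated N | scaled N p ∈ parents ⁻¹' R} : ℝ) / totientSum N)) atTop (𝓝 0) := by
    refine squeeze_zero_norm' ?_ tendsto_succ_div_totientSum
    filter_upwards [eventually_gt_atTop 0] with N hN
    rw [← sub_div, ← sub_div, norm_div, Real.norm_eq_abs, Real.norm_natCast]
    gcongr
    exact ncard_denominatorsIn_of_lt hN hR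
  have := h3.add (h1.sub h2)
  rw [zero_add] at this
  exact this.congr fun N => by ring

end Counting

/-! ### Measure-preserving changes of variables -/

section ChangeOfVariables

theorem setIntegral_preimage_eq {T S : ℝ × ℝ → ℝ × ℝ} (hT : MeasurePreserving T volume volume)
    (hc : Continuous T) (hS : ∀ p, S (T p) = p) (f : ℝ × ℝ → ℝ) (R : Set (ℝ × ℝ)) :
    ∫ p in T ⁻¹' R, f p = ∫ p in R, f (S p) := by
  have hi : Function.Injective T := Function.LeftInverse.injective hS
  rw [← hT.setIntegral_preimage_emb (hc.measurableEmbedding hi) (fun p => f (S p)) R]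
  simp only [hS]

theorem integrable_comp_inverse {T S : ℝ × ℝ → ℝ × ℝ} (hT : MeasurePreserving T volume volume)
    (hc : Continuous T) (hS : ∀ p, S (T p) = p) {f : ℝ × ℝ → ℝ} (hf : Integrable f) :
    Integrable fun p => f (S p) := by
  have hi : Function.Injective T := Function.LeftInverse.injective hS
  rw [← hT.integrable_comp_emb (hc.measurableEmbedding hi)]
  simpa only [Function.comp_def, hS] using hf

theorem measurePreserving_reflect : MeasurePreserving reflect volume volume := by
  have h := ((MeasurePreserving.id (volume : Measure ℝ)).prod
    (Measure.measurePreserving_neg (volume : Measure ℝ))).comp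
    (measurePreserving_prod_sub (volume : Measure ℝ) (volume : Measure ℝ))
  have e : reflect = Prod.map id Neg.neg ∘ fun z : ℝ × ℝ => (z.1, z.2 - z.1) := by
    ext p <;> simp [reflect]
  rw [e]
  exact h

theorem measurePreserving_parents : MeasurePreserving parents volume volume := by
  exact (measurePreserving_prod_sub (volume : Measure ℝ) (volume : Measure ℝ)).comp
    (Measure.measurePreserving_swap (μ := (volume : Measure ℝ)) (ν := (volume : Measure ℝ)))

theorem measurePreserving_swap_real :
    MeasurePreserving (Prod.swap : ℝ × ℝ → ℝ × ℝ) volume volume :=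
  Measure.measurePreserving_swap

end ChangeOfVariables

/-! ### The normalising constant `log (4 / 3)` -/

section Total

theorem lintegral_Ioo_eq {f F : ℝ → ℝ} (hF : ∀ x ∈ Set.Icc (0 : ℝ) 1, HasDerivAt F (f x) x)
    (hf : ContinuousOn f (Set.Icc 0 1)) (h0 : ∀ x ∈ Set.Ioo (0 : ℝ) 1, 0 ≤ f x) :
    ∫⁻ x in Set.Ioo (0 : ℝ) 1, ENNReal.ofReal (f x) = ENNReal.ofReal (F 1 - F 0) := by
  have hi : IntervalIntegrable f volume 0 1 :=
    ContinuousOn.intervalIntegrable (by rwa [Set.uIcc_of_le zero_le_one])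
  rw [← ofReal_integral_eq_lintegral_ofReal (hf.integrableOn_Icc.mono_set Set.Ioo_subset_Icc_self),
    ← integral_Ioc_eq_integral_Ioo, ← intervalIntegral.integral_of_le zero_le_one,
    intervalIntegral.integral_eq_sub_of_hasDerivAt (by rwa [Set.uIcc_of_le zero_le_one]) hi]
  rw [EventuallyLE, ae_restrict_iff' measurableSet_Ioo]
  exact Eventually.of_forall h0

theorem radial_Ioc {t : ℝ} (h0 : 0 < t) (h1 : t < 1) :
    radial (Set.Ioc 0 t) = ENNReal.ofReal (t ^ 2) := by
  have e : Set.Ioc 0 t ∩ Set.Ioo 0 1 = Set.Ioc 0 t :=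
    Set.inter_eq_left.mpr fun x hx => ⟨hx.1, hx.2.trans_lt h1⟩
  rw [radial, withDensity_apply _ measurableSet_Ioc, Measure.restrict_restrict measurableSet_Ioc, e,
    ← ofReal_integral_eq_lintegral_ofReal, ← intervalIntegral.integral_of_le h0.le,
    intervalIntegral.integral_const_mul, integral_id]
  · congr 1
    ring
  · exact ((continuous_const.mul continuous_id).integrableOn_Icc (a := (0 : ℝ)) (b := t)).mono_set
      Set.Ioc_subset_Icc_self
  · rw [EventuallyLE, ae_restrict_iff' measurableSet_Ioc]
    exact Eventually.of_forall fun x hx => by simpa using hx.1.le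

/-- Computed on the cube rather than in the plane: for fixed `(u, v)` the condition `x (1 + u + v) ≤
1` has radial mass `1 / (1 + u + v) ^ 2`, whose integral over the unit square is `2 log 2 - log 3`.
-/
theorem integral_weight : ∫ p, weight p = Real.log (4 / 3) := by
  have hS := measurableSet_truncatedCone MeasurableSet.univ
  have key : cubeMeasure (homog ⁻¹' truncatedCone Set.univ) = ENNReal.ofReal (Real.log (4 / 3)) := by
    rw [cubeMeasure, Measure.prod_apply_symm (continuous_homog.measurable hS),
      Measure.prod_restrict, ← Measure.volume_eq_prod]
    have h1 : ∀ q ∈ (Set.Ioo (0 : ℝ) 1 ×ˢ Set.Ioo (0 : ℝ) 1),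
        radial ((fun x => (x, q)) ⁻¹' (homog ⁻¹' truncatedCone Set.univ)) =
          ENNReal.ofReal ((1 / (1 + q.1 + q.2)) ^ 2) := by
      rintro ⟨u, v⟩ ⟨⟨hu0, hu1⟩, ⟨hv0, hv1⟩⟩
      simp only at hu0 hu1 hv0 hv1 ⊢
      have hpos : 0 < 1 + u + v := by linarith
      rw [← radial_Ioc (by positivity) (by rw [div_lt_one hpos]; linarith)]
      congr 1
      ext x
      simp only [homog, truncatedCone, Set.mem_preimage, Set.mem_ofPred_eq, Set.mem_univ, and_true,
        Set.mem_Ioc, le_div_iff₀ hpos]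
      rw [mul_pos_iff_of_pos_right hu0]
      refine and_congr_right fun _ => ?_
      rw [mul_add, mul_add, mul_one]
    rw [setLIntegral_congr_fun (measurableSet_Ioo.prod measurableSet_Ioo) h1,
      Measure.volume_eq_prod, ← Measure.prod_restrict, lintegral_prod _ (by fun_prop)]
    have h2 : ∀ u ∈ Set.Ioo (0 : ℝ) 1,
        ∫⁻ v in Set.Ioo (0 : ℝ) 1, ENNReal.ofReal ((1 / (1 + u + v)) ^ 2) =
          ENNReal.ofReal (1 / (1 + u) - 1 / (2 + u)) := by
      intro u hu
      have hne : ∀ v ∈ Set.Icc (0 : ℝ) 1, 1 + u + v ≠ 0 := fun v hv => by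
        have := hu.1; have := hv.1; positivity
      rw [lintegral_Ioo_eq (F := fun v => -(1 + u + v)⁻¹)]
      · congr 1
        have : 1 + u ≠ 0 := by have := hu.1; positivity
        have : 2 + u ≠ 0 := by have := hu.1; positivity
        have : 1 + u + 1 = 2 + u := by ring
        simp only [this, add_zero]
        ring
      · intro v hv
        have := (((hasDerivAt_id v).const_add (1 + u)).inv (hne v hv)).neg
        have e : (1 / (1 + u + v)) ^ 2 = -(-1 / (1 + u + id v) ^ 2) := by
          rw [id, div_pow, neg_div, neg_neg, one_pow]
        rw [e]
        exact this
      · exact (continuousOn_const.div (by fun_prop) hne).pow 2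
      · intro v _
        positivity
    rw [setLIntegral_congr_fun measurableSet_Ioo h2]
    rw [lintegral_Ioo_eq (F := fun u => Real.log (1 + u) - Real.log (2 + u))]
    · congr 1
      have e1 : (1 + 1 : ℝ) = 2 := by norm_num
      have e2 : (2 + 1 : ℝ) = 3 := by norm_num
      have e3 : (4 / 3 : ℝ) = 2 * 2 / 3 := by norm_num
      rw [e1, e2, e3, Real.log_div (by norm_num) (by norm_num),
        Real.log_mul (by norm_num) (by norm_num), add_zero, add_zero, Real.log_one]
      ring
    · intro u hu
      have h1 : 1 + u ≠ 0 := by have := hu.1; positivity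
      have h2 : 2 + u ≠ 0 := by have := hu.1; positivity
      exact (((hasDerivAt_id u).const_add 1).log h1).sub (((hasDerivAt_id u).const_add 2).log h2)
    · refine (continuousOn_const.div (by fun_prop) fun u hu => ?_).sub
        (continuousOn_const.div (by fun_prop) fun u hu => ?_)
      · have := hu.1; positivity
      · have := hu.1; positivity
    · intro u hu
      rw [sub_nonneg]
      have := hu.1
      gcongr
      norm_num
  rw [cubeMeasure_truncatedCone MeasurableSet.univ, Measure.restrict_univ] at key
  rw [integral_eq_lintegral_of_nonneg_ae (Eventually.of_forall weight_nonneg)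
    measurable_weight.aestronglyMeasurable, key, ENNReal.toReal_ofReal]
  exact Real.log_nonneg (by norm_num)

theorem volume_graph_eq_zero {f : ℝ → ℝ} (hf : Measurable f) :
    volume {p : ℝ × ℝ | p.1 = f p.2} = 0 := by
  have hm : MeasurableSet {p : ℝ × ℝ | p.1 = f p.2} :=
    measurableSet_eq_fun measurable_fst (hf.comp measurable_snd)
  rw [Measure.volume_eq_prod, Measure.prod_apply_symm hm]
  have : ∀ y, (fun x => (x, y)) ⁻¹' {p : ℝ × ℝ | p.1 = f p.2} = {f y} := fun y => by
    ext x; simp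
  simp [this]

theorem convex_setOf_gt : Convex ℝ {p : ℝ × ℝ | p.2 < p.1} := by
  have h : {p : ℝ × ℝ | p.2 < p.1} = {p : ℝ × ℝ | p.2 - p.1 < 0} := by
    ext p; simp [sub_neg]
  rw [h]
  exact convex_halfSpace_lt ⟨fun x y => by simp; ring, fun c x => by simp; ring⟩ 0

theorem convex_setOf_lt : Convex ℝ {p : ℝ × ℝ | p.1 < p.2} := by
  have h : {p : ℝ × ℝ | p.1 < p.2} = {p : ℝ × ℝ | p.1 - p.2 < 0} := by
    ext p; simp [sub_neg]
  rw [h]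
  exact convex_halfSpace_lt ⟨fun x y => by simp; ring, fun c x => by simp; ring⟩ 0

theorem measurableSet_setOf_gt : MeasurableSet {p : ℝ × ℝ | p.2 < p.1} :=
  measurableSet_lt measurable_snd measurable_fst

theorem measurableSet_setOf_lt : MeasurableSet {p : ℝ × ℝ | p.1 < p.2} :=
  measurableSet_lt measurable_fst measurable_snd

theorem ne_of_mem_denominators {Q q₁ q₂ : ℕ} (h : (q₁, q₂) ∈ denominators Q) : q₁ ≠ q₂ := by
  rintro rfl
  have h2 := two_le_of_mem_denominators h
  obtain ⟨a₁, a₂, -, -, -, -, hu, -⟩ := mem_denominators_iff.mp h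
  have : q₁ ∣ 1 := (Nat.dvd_add_right (dvd_mul_left q₁ a₁)).mp (hu ▸ dvd_mul_left q₁ a₂)
  have := Nat.le_of_dvd one_pos this
  omega

/-- Each side of the diagonal contributes the full integral of `weight` minus a part, and the two
parts add up to one full integral. The diagonal itself carries no pairs. -/
theorem tendsto_ncard_denominators :
    Tendsto (fun N => ((denominators N).ncard : ℝ) / totientSum N) atTop
      (𝓝 (Real.log (4 / 3))) := by
  have h1 := tendsto_ncard_of_gt measurableSet_setOf_gt convex_setOf_gt fun p hp => hp
  have h2 := tendsto_ncard_of_lt measurableSet_setOf_lt convex_setOf_lt fun p hp => hp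
  have hw : ∀ s : Set (ℝ × ℝ), (∀ p, 0 < p.2 ∧ p.2 < p.1 → p ∈ s) →
      ∫ p in s, weight p = ∫ p, weight p := by
    intro s hs
    refine setIntegral_eq_integral_of_forall_compl_eq_zero fun p hp => ?_
    rw [weight, if_neg fun h => hp (hs p h)]
  have e1 : ∫ p in reflect ⁻¹' {p : ℝ × ℝ | p.2 < p.1}, weight p = ∫ p, weight p :=
    hw _ fun p hp => by simpa [reflect] using hp.1
  have e2 : ∫ p in Prod.swap ⁻¹' {p : ℝ × ℝ | p.1 < p.2}, weight p = ∫ p, weight p :=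
    hw _ fun p hp => by simpa using hp.2
  have e3 : (∫ p in parents ⁻¹' {p : ℝ × ℝ | p.2 < p.1}, weight p) +
      ∫ p in parents ⁻¹' {p : ℝ × ℝ | p.1 < p.2}, weight p = ∫ p, weight p := by
    rw [← integral_add_compl (continuous_parents.measurable measurableSet_setOf_gt)
      integrable_weight]
    congr 1
    refine setIntegral_congr_set ?_
    have hnull : ∀ᵐ p : ℝ × ℝ, p.1 ≠ 2 * p.2 := by
      rw [ae_iff]
      simpa using volume_graph_eq_zero (f := fun y => 2 * y) (by fun_prop)
    filter_upwards [hnull] with p hp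
    refine propext ?_
    change p.2 < p.1 - p.2 ↔ ¬ (p.1 - p.2 < p.2)
    constructor
    · intro h; linarith
    · intro h
      refine lt_of_le_of_ne (not_lt.mp h) fun h' => hp (by linarith)
  have h3 := h1.add h2
  rw [e1, e2] at h3
  have e4 : (∫ p, weight p) - (∫ p in parents ⁻¹' {p : ℝ × ℝ | p.2 < p.1}, weight p) +
      ((∫ p, weight p) - ∫ p in parents ⁻¹' {p : ℝ × ℝ | p.1 < p.2}, weight p) =
      Real.log (4 / 3) := by
    rw [← integral_weight]
    linarith
  rw [e4] at h3
  refine h3.congr' ?_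
  filter_upwards [eventually_gt_atTop 0] with N hN
  rw [← add_div, ← Nat.cast_add]
  congr 2
  have hf : ∀ R, (denominatorsIn N R).Finite := fun R =>
    (denominators_finite N).subset fun p hp => hp.1
  rw [← Set.ncard_union_eq _ (hf _) (hf _)]
  · congr 1
    ext ⟨q₁, q₂⟩
    rw [Set.mem_union, mem_denominatorsIn hN, mem_denominatorsIn hN, ← and_or_left]
    refine ⟨fun h => h.1, fun h => ⟨h, ?_⟩⟩
    rcases lt_or_gt_of_ne (ne_of_mem_denominators h) with hq | hq
    · exact Or.inr ((lt_iff_scaled hN).mpr hq)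
    · exact Or.inl ((gt_iff_scaled hN).mpr hq)
  · rw [Set.disjoint_left]
    intro p hp hp'
    have h1 : (scaled N p).2 < (scaled N p).1 := ((mem_denominatorsIn hN).mp hp).2
    have h2 : (scaled N p).1 < (scaled N p).2 := ((mem_denominatorsIn hN).mp hp').2
    exact lt_asymm h1 h2

end Total

/-! ### The three regions and positivity of the densities -/

section Regions

theorem V_eq_union : V = V₁ ∪ V₂ ∪ V₃ := by
  ext ⟨x, y⟩
  simp only [V, V₁, V₂, V₃, Set.mem_union, Set.mem_ofPred_eq, Set.mem_Icc, max_le_iff, le_max_iff,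
    le_min_iff]
  constructor
  · rintro ⟨⟨h1, h2⟩, ⟨h3, h4⟩, ⟨h5, h6⟩, h7⟩
    rcases le_total y x with hyx | hyx
    · rcases le_total y (1 - x) with h | h
      · right
        exact ⟨⟨by linarith, by linarith⟩, ⟨h3, by linarith⟩, ⟨⟨h5, h3⟩, h6⟩, hyx, h⟩
      · left; left
        exact ⟨⟨by linarith, h2⟩, ⟨by linarith, h4⟩, ⟨h, h6⟩, hyx⟩
    · left
      rcases h7 with h | h
      · right
        exact ⟨⟨h1, by linarith⟩, ⟨by linarith, h4⟩, ⟨h5, hyx⟩, h⟩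
      · rcases le_total y (1 - x) with h' | h'
        · right
          exact ⟨⟨h1, by linarith⟩, ⟨by linarith, h4⟩, ⟨h5, hyx⟩, h'⟩
        · left
          exact ⟨⟨by linarith, h2⟩, ⟨by linarith, h4⟩, ⟨h', h6⟩, h⟩
  · rintro ((⟨⟨h1, h2⟩, ⟨h3, h4⟩, ⟨h5, h6⟩, h7⟩ | ⟨⟨h1, h2⟩, ⟨h3, h4⟩, ⟨h5, h6⟩, h7⟩) |
      ⟨⟨h1, h2⟩, ⟨h3, h4⟩, ⟨⟨h5, h6⟩, h7⟩, h8, h9⟩)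
    · exact ⟨⟨by linarith, h2⟩, ⟨by linarith, h4⟩, ⟨by linarith, h6⟩, Or.inr h7⟩
    · exact ⟨⟨h1, by linarith⟩, ⟨by linarith, h4⟩, ⟨h5, by linarith⟩, Or.inl h7⟩
    · exact ⟨⟨by linarith, by linarith⟩, ⟨h3, by linarith⟩, ⟨h5, h7⟩, Or.inl h9⟩

/-- Diagonal shifts in all four directions turn the weak inequalities defining a region into strict
ones at interior points. -/
theorem exists_shift_of_mem_interior {S : Set (ℝ × ℝ)} {p : ℝ × ℝ} (hp : p ∈ interior S) :
    ∃ δ > 0, (p.1 + δ, p.2 + δ) ∈ S ∧ (p.1 + δ, p.2 - δ) ∈ S ∧ (p.1 - δ, p.2 + δ) ∈ S ∧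
      (p.1 - δ, p.2 - δ) ∈ S := by
  obtain ⟨ε, hε, h⟩ := Metric.mem_nhds_iff.mp (mem_interior_iff_mem_nhds.mp hp)
  have hd : ∀ s t : ℝ, |s| ≤ ε / 2 → |t| ≤ ε / 2 → (p.1 + s, p.2 + t) ∈ S := by
    intro s t hs ht
    refine h ?_
    rw [Metric.mem_ball, Prod.dist_eq, max_lt_iff, Real.dist_eq, Real.dist_eq,
      add_sub_cancel_left, add_sub_cancel_left]
    constructor <;> linarith
  have h1 : |ε / 2| ≤ ε / 2 := (abs_of_pos (by positivity)).le
  have h2 : |-(ε / 2)| ≤ ε / 2 := by rwa [abs_neg]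
  exact ⟨ε / 2, by positivity, hd _ _ h1 h1, hd _ _ h1 h2, hd _ _ h2 h1, hd _ _ h2 h2⟩

theorem of_mem_interior_V₁ {p : ℝ × ℝ} (hp : p ∈ interior V₁) :
    p.2 < p.1 ∧ 1 - p.1 < p.2 ∧ 2 * p.1 - 1 < p.2 := by
  obtain ⟨δ, hδ, -, h1, h2, h3⟩ := exists_shift_of_mem_interior hp
  simp only [V₁, Set.mem_ofPred_eq, Set.mem_Icc, max_le_iff] at h1 h2 h3
  exact ⟨by linarith [h2.2.2.2], by linarith [h3.2.2.1.1], by linarith [h1.2.2.1.2]⟩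

theorem of_mem_interior_V₂ {p : ℝ × ℝ} (hp : p ∈ interior V₂) :
    0 < p.1 ∧ p.1 < p.2 ∧ p.2 < 1 - p.1 ∧ 1 - 3 * p.1 < 2 * p.2 := by
  obtain ⟨δ, hδ, h1, h2, -, h3⟩ := exists_shift_of_mem_interior hp
  simp only [V₂, Set.mem_ofPred_eq, Set.mem_Icc, max_le_iff] at h1 h2 h3
  exact ⟨by linarith [h3.1.1], by linarith [h2.2.2.1.2], by linarith [h1.2.2.2],
    by linarith [h3.2.2.1.1]⟩

theorem of_mem_interior_V₃ {p : ℝ × ℝ} (hp : p ∈ interior V₃) :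
    0 < p.2 ∧ p.2 < p.1 ∧ p.2 < 1 - p.1 ∧ 1 - 3 * p.1 < 2 * p.2 ∧ 2 * p.1 - 1 < p.2 := by
  obtain ⟨δ, hδ, h1, h2, h3, h4⟩ := exists_shift_of_mem_interior hp
  simp only [V₃, Set.mem_ofPred_eq, Set.mem_Icc, max_le_iff, le_min_iff] at h1 h2 h3 h4
  exact ⟨by linarith [h4.2.1.1], by linarith [h3.2.2.2.1], by linarith [h1.2.2.2.2],
    by linarith [h4.2.2.1.1.1], by linarith [h2.2.2.1.2]⟩

theorem disjoint_interior_V₁_V₂ : Disjoint (interior V₁) (interior V₂) :=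
  Set.disjoint_left.mpr fun _ h h' =>
    lt_asymm (of_mem_interior_V₁ h).1 (of_mem_interior_V₂ h').2.1

theorem disjoint_interior_V₁_V₃ : Disjoint (interior V₁) (interior V₃) :=
  Set.disjoint_left.mpr fun _ h h' =>
    lt_asymm (of_mem_interior_V₁ h).2.1 (of_mem_interior_V₃ h').2.2.1

theorem disjoint_interior_V₂_V₃ : Disjoint (interior V₂) (interior V₃) :=
  Set.disjoint_left.mpr fun _ h h' =>
    lt_asymm (of_mem_interior_V₂ h).2.1 (of_mem_interior_V₃ h').2.1

theorem disjoint_interior_region (i j : Fin 3) (h : i ≠ j) :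
    Disjoint (interior (region i)) (interior (region j)) := by
  fin_cases i <;> fin_cases j
  · exact absurd rfl h
  · exact disjoint_interior_V₁_V₂
  · exact disjoint_interior_V₁_V₃
  · exact disjoint_interior_V₁_V₂.symm
  · exact absurd rfl h
  · exact disjoint_interior_V₂_V₃
  · exact disjoint_interior_V₁_V₃.symm
  · exact disjoint_interior_V₂_V₃.symm
  · exact absurd rfl h

/-- The floor term never attains a smaller value than `(1 - x - y) / y`, because `⌊y / x⌋ x ≤ y` and
`x ≤ y`. -/
theorem H₂_eq {x y : ℝ} (hx : 0 < x) (hxy : x ≤ y) (hy : y ≤ 1 - x) :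
    H₂ (x, y) = min ((1 - x - y) / y) 1 - max ((1 - 2 * x - y) / (x + y)) 0 := by
  have hy0 : 0 < y := hx.trans_le hxy
  have hk : (⌊y / x⌋ : ℝ) * x ≤ y := by
    rw [← le_div_iff₀ hx]; exact Int.floor_le _
  have hC : 0 ≤ (1 - x - y) / y := div_nonneg (by linarith) hy0.le
  have h : (1 - x - y) / y ≤ (1 + y - (2 + (⌊y / x⌋ : ℝ)) * x) / x := by
    rw [le_div_iff₀ hx]
    have h1 : (1 - x - y) / y * x ≤ (1 - x - y) / y * y := mul_le_mul_of_nonneg_left hxy hC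
    rw [div_mul_cancel₀ _ hy0.ne'] at h1
    linarith
  simp only [H₂]
  rw [min_eq_right h]

/-- The floor term is dominated since `⌊x / y⌋ ≥ 1`. The rest is `min (1 - B) 1 - max (1 - A) 0 =
min A 1 - max B 0`, which exhibits the reflected and the child weights. -/
theorem H₃_eq {x y : ℝ} (hy : 0 < y) (hyx : y ≤ x) (h1 : 2 * x - 1 ≤ y) :
    H₃ (x, y) = min ((1 + y - 2 * x) / x) 1 - max ((1 - 2 * x - y) / (x + y)) 0 := by
  have hx : 0 < x := hy.trans_le hyx
  have hxy : 0 < x + y := by linarith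
  have hk : (1 : ℝ) ≤ ⌊x / y⌋ := by
    have : (1 : ℤ) ≤ ⌊x / y⌋ := Int.le_floor.mpr (by rw [Int.cast_one, one_le_div hy]; exact hyx)
    exact_mod_cast this
  have hA : 0 ≤ (1 + y - 2 * x) / x := div_nonneg (by linarith) hx.le
  have e1 : (3 * x + 2 * y - 1) / (x + y) = 1 - (1 - 2 * x - y) / (x + y) := by
    field_simp
    ring
  have e2 : (3 * x - y - 1) / x = 1 - (1 + y - 2 * x) / x := by
    field_simp
    ring
  have h : (x + (2 - (⌊x / y⌋ : ℝ)) * y - 1) / y ≤ (3 * x - y - 1) / x := by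
    rw [e2, div_le_iff₀ hy, sub_mul, sub_mul, one_mul]
    have h2 : (1 + y - 2 * x) / x * y ≤ (1 + y - 2 * x) / x * x :=
      mul_le_mul_of_nonneg_left hyx hA
    rw [div_mul_cancel₀ _ hx.ne'] at h2
    have h3 : y ≤ ⌊x / y⌋ * y := le_mul_of_one_le_left hy.le hk
    linarith
  simp only [H₃]
  rw [max_eq_left h, e1, e2]
  set A := (1 + y - 2 * x) / x
  set B := (1 - 2 * x - y) / (x + y)
  rcases le_total A 1 with hA1 | hA1 <;> rcases le_total B 0 with hB | hB
  · rw [min_eq_right (by linarith), max_eq_left (by linarith), min_eq_left hA1, max_eq_right hB]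
    ring
  · rw [min_eq_left (by linarith), max_eq_left (by linarith), min_eq_left hA1, max_eq_left hB]
    ring
  · rw [min_eq_right (by linarith), max_eq_right (by linarith), min_eq_right hA1, max_eq_right hB]
  · rw [min_eq_left (by linarith), max_eq_right (by linarith), min_eq_right hA1, max_eq_left hB]
    ring

theorem density_pos (i : Fin 3) {p : ℝ × ℝ} (hp : p ∈ interior (region i)) : 0 < density i p := by
  obtain ⟨x, y⟩ := p
  fin_cases i
  · obtain ⟨h1, h2, h3⟩ := of_mem_interior_V₁ hp
    simp only at h1 h2 h3
    change 0 < (1 + y - 2 * x) / x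
    exact div_pos (by linarith) (by linarith)
  · obtain ⟨h1, h2, h3, h4⟩ := of_mem_interior_V₂ hp
    simp only at h1 h2 h3 h4
    have hy : 0 < y := by linarith
    have hxy : 0 < x + y := by linarith
    change 0 < H₂ (x, y)
    rw [H₂_eq h1 h2.le h3.le, sub_pos, lt_min_iff, max_lt_iff, max_lt_iff]
    refine ⟨⟨?_, div_pos (by linarith) hy⟩, ?_, one_pos⟩
    · rw [div_lt_div_iff₀ hxy hy]
      -- The two sides differ by exactly `x (1 - x)`.
      nlinarith [mul_pos h1 (show 0 < 1 - x by linarith)]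
    · rw [div_lt_one hxy]
      linarith
  · obtain ⟨h1, h2, h3, h4, h5⟩ := of_mem_interior_V₃ hp
    simp only at h1 h2 h3 h4 h5
    have hx : 0 < x := by linarith
    have hxy : 0 < x + y := by linarith
    change 0 < H₃ (x, y)
    rw [H₃_eq h1 h2.le h5.le, sub_pos, lt_min_iff, max_lt_iff, max_lt_iff]
    refine ⟨⟨?_, div_pos (by linarith) hx⟩, ?_, one_pos⟩
    · rw [div_lt_div_iff₀ hxy hx]
      -- The two sides differ by exactly `y + y ^ 2`.
      nlinarith [mul_pos h1 h1]
    · rw [div_lt_one hxy]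
      linarith

end Regions

/-! ### Identification of the densities and the limit on boxes -/

section Boxes

/-- The inverse of `parents`. -/
def child (p : ℝ × ℝ) : ℝ × ℝ := (p.1 + p.2, p.1)

theorem child_parents (p : ℝ × ℝ) : child (parents p) = p := by
  simp [child, parents]

theorem reflect_reflect (p : ℝ × ℝ) : reflect (reflect p) = p := by
  simp [reflect]

/-- The edge `2 y = 1 - 3 x` of the region is where the cap `1` in `weight` would become active. -/
theorem weight_child {x y : ℝ} (hx : 0 < x) (hy : 0 < y) (h : 1 - 3 * x ≤ 2 * y) :
    weight (child (x, y)) = 2 * max ((1 - 2 * x - y) / (x + y)) 0 := by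
  have hxy : 0 < x + y := by linarith
  have e : 1 - (x + y) - x = 1 - 2 * x - y := by ring
  refine (if_pos ⟨hx, by simp only [child]; linarith⟩).trans ?_
  simp only [child]
  rw [e, min_eq_right, max_comm]
  rw [div_le_one hxy]
  linarith

theorem weight_reflect {x y : ℝ} (hy : 0 < y) (hyx : y < x) (h : 2 * x - 1 ≤ y) :
    weight (reflect (x, y)) = 2 * min ((1 + y - 2 * x) / x) 1 := by
  have hx : 0 < x := by linarith
  have e : 1 - x - (x - y) = 1 + y - 2 * x := by ring
  refine (if_pos ⟨by simp only [reflect]; linarith, by simp only [reflect]; linarith⟩).trans ?_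
  simp only [reflect]
  rw [e, max_eq_right, min_comm]
  exact le_min zero_le_one (div_nonneg (by linarith) hx.le)

theorem weight_swap {x y : ℝ} (hx : 0 < x) (hxy : x < y) (h : y ≤ 1 - x) :
    weight (x, y).swap = 2 * min ((1 - x - y) / y) 1 := by
  have hy : 0 < y := by linarith
  have e : 1 - y - x = 1 - x - y := by ring
  simp only [Prod.swap_prod_mk, weight]
  rw [if_pos ⟨by linarith, by linarith⟩, e, max_eq_right, min_comm]
  exact le_min zero_le_one (div_nonneg (by linarith) hy.le)

/-- Here `x + y ≥ 1` annihilates the child weight, and `1 + y ≤ 3 x` makes the cap in the reflected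
weight inactive. -/
theorem weight_eq_density_V₁ {p : ℝ × ℝ} (hp : p ∈ V₁) (h : p.2 < p.1) :
    weight (reflect p) - weight (child p) = 2 * H₁ p := by
  obtain ⟨x, y⟩ := p
  simp only [V₁, Set.mem_ofPred_eq, Set.mem_Icc, max_le_iff] at hp h
  obtain ⟨⟨h1, h2⟩, ⟨h3, h4⟩, ⟨h5, h6⟩, h7⟩ := hp
  rw [weight_reflect (by linarith) h h6, weight_child (by linarith) (by linarith) (by linarith),
    min_eq_left, max_eq_right]
  · simp [H₁]
  · exact div_nonpos_of_nonpos_of_nonneg (by linarith) (by linarith)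
  · rw [div_le_one (by linarith)]
    linarith

theorem weight_eq_density_V₂ {p : ℝ × ℝ} (hp : p ∈ V₂) (h0 : p.1 ≠ 0) (h : p.1 < p.2) :
    weight p.swap - weight (child p) = 2 * H₂ p := by
  obtain ⟨x, y⟩ := p
  simp only [V₂, Set.mem_ofPred_eq, Set.mem_Icc, max_le_iff] at hp h h0
  obtain ⟨⟨h1, h2⟩, ⟨h3, h4⟩, ⟨h5, h6⟩, h7⟩ := hp
  have hx : 0 < x := lt_of_le_of_ne h1 (Ne.symm h0)
  rw [weight_swap hx h h7, weight_child hx (by linarith) (by linarith), H₂_eq hx h6 h7]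
  ring

theorem weight_eq_density_V₃ {p : ℝ × ℝ} (hp : p ∈ V₃) (h0 : p.2 ≠ 0) (h : p.2 < p.1) :
    weight (reflect p) - weight (child p) = 2 * H₃ p := by
  obtain ⟨x, y⟩ := p
  simp only [V₃, Set.mem_ofPred_eq, Set.mem_Icc, max_le_iff, le_min_iff] at hp h h0
  obtain ⟨⟨h1, h2⟩, ⟨h3, h4⟩, ⟨⟨h5, h6⟩, h7⟩, h8, h9⟩ := hp
  have hy : 0 < y := lt_of_le_of_ne h3 (Ne.symm h0)
  rw [weight_reflect hy h h7, weight_child (by linarith) hy (by linarith), H₃_eq hy h8 h7]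
  ring

theorem ae_ne_snd : ∀ᵐ p : ℝ × ℝ, p.1 ≠ p.2 := by
  rw [ae_iff]
  simpa using volume_graph_eq_zero (f := fun y => y) measurable_id

theorem ae_fst_ne_zero : ∀ᵐ p : ℝ × ℝ, p.1 ≠ 0 := by
  rw [ae_iff]
  simpa using volume_graph_eq_zero (f := fun _ => 0) measurable_const

theorem ae_snd_ne_zero : ∀ᵐ p : ℝ × ℝ, p.2 ≠ 0 :=
  measurePreserving_swap_real.quasiMeasurePreserving.ae ae_fst_ne_zero

/-- Transfer of the asymptotics from `R'`, obtained from `R` by removing the diagonal, to `R`. -/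
theorem integrableOn_and_tendsto {R R' : Set (ℝ × ℝ)} {f G : ℝ × ℝ → ℝ}
    (hR : ∀ p, p ∈ R' ↔ p ∈ R ∧ p.1 ≠ p.2) (hm : MeasurableSet R') (hG : Integrable G)
    (hfG : ∀ᵐ p, p ∈ R' → G p = 2 * f p)
    (hlim : Tendsto (fun N => ((denominatorsIn N R').ncard : ℝ) / totientSum N) atTop
      (𝓝 (∫ p in R', G p))) :
    IntegrableOn f R volume ∧
      Tendsto (fun N : ℕ => ((denominatorsIn N R).ncard : ℝ) / ((denominators N).ncard : ℝ)) atTop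
        (𝓝 (2 / Real.log (4 / 3) * ∫ p in R, f p ∂volume)) := by
  have hRR : R' =ᵐ[volume] R := by
    filter_upwards [ae_ne_snd] with p hp
    exact propext ((hR p).trans (and_iff_left hp))
  have hfG' : G =ᵐ[volume.restrict R'] fun p => 2 * f p := (ae_restrict_iff' hm).mpr hfG
  constructor
  · have h1 : IntegrableOn (fun p => 2 * f p) R' := (hG.integrableOn (s := R')).congr_fun_ae hfG'
    have h2 := h1.const_mul (1 / 2)
    simp only [← mul_assoc] at h2
    norm_num at h2
    exact IntegrableOn.congr_set_ae h2 hRR.symm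
  · have hlog : Real.log (4 / 3) ≠ 0 := (Real.log_pos (by norm_num)).ne'
    have h1 : (∫ p in R', G p) / Real.log (4 / 3) =
        2 / Real.log (4 / 3) * ∫ p in R, f p ∂volume := by
      rw [integral_congr_ae hfG', integral_const_mul, setIntegral_congr_set hRR]
      ring
    rw [← h1]
    refine (hlim.div tendsto_ncard_denominators hlog).congr' ?_
    filter_upwards [eventually_gt_atTop 0] with N hN
    have hN3 : (totientSum N : ℝ) ≠ 0 := by exact_mod_cast (totientSum_pos hN).ne'
    have hset : denominatorsIn N R' = denominatorsIn N R := by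
      ext ⟨q₁, q₂⟩
      rw [mem_denominatorsIn hN, mem_denominatorsIn hN, hR]
      refine ⟨fun h => ⟨h.1, h.2.1⟩, fun h => ⟨h.1, h.2, fun he => ?_⟩⟩
      rcases lt_or_gt_of_ne (ne_of_mem_denominators h.1) with hq | hq
      · exact ((lt_iff_scaled hN).mpr hq).ne he
      · exact ((gt_iff_scaled hN).mpr hq).ne' he
    rw [Pi.div_apply, hset, div_div_div_cancel_right₀ hN3]

theorem limit_of_gt {R : Set (ℝ × ℝ)} {f : ℝ × ℝ → ℝ} (hm : MeasurableSet R) (hc : Convex ℝ R)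
    (hR : ∀ p ∈ R, p.2 ≤ p.1)
    (hf : ∀ᵐ p, p ∈ R → p.2 < p.1 → weight (reflect p) - weight (child p) = 2 * f p) :
    IntegrableOn f R volume ∧
      Tendsto (fun N : ℕ => ((denominatorsIn N R).ncard : ℝ) / ((denominators N).ncard : ℝ)) atTop
        (𝓝 (2 / Real.log (4 / 3) * ∫ p in R, f p ∂volume)) := by
  have hm' := hm.inter measurableSet_setOf_gt
  have i1 := integrable_comp_inverse measurePreserving_reflect continuous_reflect reflect_reflect
    integrable_weight
  have i2 := integrable_comp_inverse measurePreserving_parents continuous_parents child_parents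
    integrable_weight
  refine integrableOn_and_tendsto (R' := R ∩ {p | p.2 < p.1}) (fun p => ?_) hm' (i1.sub i2) ?_ ?_
  · exact and_congr_right fun h => ⟨fun h' => (ne_of_lt h').symm,
      fun h' => lt_of_le_of_ne (hR p h) h'.symm⟩
  · filter_upwards [hf] with p hp h
    exact hp h.1 h.2
  · have := tendsto_ncard_of_gt hm' (hc.inter convex_setOf_gt) fun p hp => hp.2
    rwa [setIntegral_preimage_eq measurePreserving_reflect continuous_reflect reflect_reflect,
      setIntegral_preimage_eq measurePreserving_parents continuous_parents child_parents,
      ← integral_sub i1.integrableOn i2.integrableOn] at this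

theorem limit_of_lt {R : Set (ℝ × ℝ)} {f : ℝ × ℝ → ℝ} (hm : MeasurableSet R) (hc : Convex ℝ R)
    (hR : ∀ p ∈ R, p.1 ≤ p.2)
    (hf : ∀ᵐ p, p ∈ R → p.1 < p.2 → weight p.swap - weight (child p) = 2 * f p) :
    IntegrableOn f R volume ∧
      Tendsto (fun N : ℕ => ((denominatorsIn N R).ncard : ℝ) / ((denominators N).ncard : ℝ)) atTop
        (𝓝 (2 / Real.log (4 / 3) * ∫ p in R, f p ∂volume)) := by
  have hm' := hm.inter measurableSet_setOf_lt
  have i1 := integrable_comp_inverse measurePreserving_swap_real continuous_swap Prod.swap_swap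
    integrable_weight
  have i2 := integrable_comp_inverse measurePreserving_parents continuous_parents child_parents
    integrable_weight
  refine integrableOn_and_tendsto (R' := R ∩ {p | p.1 < p.2}) (fun p => ?_) hm' (i1.sub i2) ?_ ?_
  · exact and_congr_right fun h => ⟨fun h' => ne_of_lt h', fun h' => lt_of_le_of_ne (hR p h) h'⟩
  · filter_upwards [hf] with p hp h
    exact hp h.1 h.2
  · have := tendsto_ncard_of_lt hm' (hc.inter convex_setOf_lt) fun p hp => hp.2
    rwa [setIntegral_preimage_eq measurePreserving_swap_real continuous_swap Prod.swap_swap,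
      setIntegral_preimage_eq measurePreserving_parents continuous_parents child_parents,
      ← integral_sub i1.integrableOn i2.integrableOn] at this

theorem limit_of_subset_region (i : Fin 3) {R : Set (ℝ × ℝ)} (hm : MeasurableSet R)
    (hc : Convex ℝ R) (hR : R ⊆ region i) :
    IntegrableOn (density i) R volume ∧
      Tendsto (fun N : ℕ => ((denominatorsIn N R).ncard : ℝ) / ((denominators N).ncard : ℝ)) atTop
        (𝓝 (2 / Real.log (4 / 3) * ∫ p in R, density i p ∂volume)) := by
  fin_cases i
  · exact limit_of_gt hm hc (fun p hp => (hR hp).2.2.2)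
      (Eventually.of_forall fun p hp h => weight_eq_density_V₁ (hR hp) h)
  · refine limit_of_lt hm hc (fun p hp => (le_max_right _ _).trans (hR hp).2.2.1) ?_
    filter_upwards [ae_fst_ne_zero] with p h0 hp h
    exact weight_eq_density_V₂ (hR hp) h0 h
  · refine limit_of_gt hm hc (fun p hp => (hR hp).2.2.2.trans (min_le_left _ _)) ?_
    filter_upwards [ae_snd_ne_zero] with p h0 hp h
    exact weight_eq_density_V₃ (hR hp) h0 h

end Boxes

end SaturatedFarey

theorem theorem2 :
    SaturatedFarey.V = SaturatedFarey.V₁ ∪ SaturatedFarey.V₂ ∪ SaturatedFarey.V₃ ∧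
    (∀ i j : Fin 3, i ≠ j →
      Disjoint (interior (SaturatedFarey.region i)) (interior (SaturatedFarey.region j))) ∧
    ∀ i : Fin 3,
      (∀ p ∈ interior (SaturatedFarey.region i), 0 < SaturatedFarey.density i p) ∧
      -- a rectangular box is a product of two intervals, with or without their end points
      ∀ I J : Set ℝ, I.OrdConnected → J.OrdConnected → I ×ˢ J ⊆ SaturatedFarey.region i →
        IntegrableOn (SaturatedFarey.density i) (I ×ˢ J) volume ∧
        Tendsto
          (fun Q : ℕ =>
            ((SaturatedFarey.denominatorsIn Q (I ×ˢ J)).ncard : ℝ) /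
              ((SaturatedFarey.denominators Q).ncard : ℝ))
          atTop
          (𝓝 (2 / Real.log (4 / 3) * ∫ p in I ×ˢ J, SaturatedFarey.density i p ∂volume)) :=
  ⟨SaturatedFarey.V_eq_union, SaturatedFarey.disjoint_interior_region, fun i =>
    ⟨fun _ hp => SaturatedFarey.density_pos i hp, fun _ _ hI hJ hR =>
      SaturatedFarey.limit_of_subset_region i (hI.measurableSet.prod hJ.measurableSet)
        (hI.convex.prod hJ.convex) hR⟩⟩
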